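/- Call a group $G$ \emph{effectively residually finite with co-semi-decidable word problem} ($\mathrm{EFRF}^{+}$) if it has a finite symmetric generating set $S$ and an algorithm (Turing machine) which, given a word $w\in S^{*}$, halts if and only if $w$ represents a non-trivial element $\overline w$ of $G$, and in that case outputs (through the images of the generators, given as permutations of a finite set) a homomorphism $f_w$ from $G$ onto a finite group $Q_w$ with $f_w(\overline w)\neq 1$. For a sequence $X=(X_n)_{n\ge 1}$ of finite sets with $|X_n|\ge 2$, let $\mathcal T_X$ be the rooted tree whose vertices are the words in $X^{\ell}=X_1\times\cdots\times X_\ell$, $\ell\ge 0$, where $v$ and $vx$ are adjacent for every letter $x$, and whose root is the empty word; let $\operatorname{Aut}(\mathcal T_X)$ be the group of its automorphisms that fix the root. A subgroup $B\le\operatorname{Aut}(\mathcal T_X)$ is a \emph{branch subgroup} if it acts transitively on $X^{\ell}$ for every $\ell\ge 0$ and if, for every $\ell\ge 0$, the subgroup generated by the rigid stabilizers $\operatorname{RiSt}_B(v)$, $v\in X^{\ell}$, has finite index in $B$; here $\operatorname{RiSt}_B(v)$ consists of the elements of $B$ that fix $v$ and every vertex that does not start with $v$. A \emph{branch group} is a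 group isomorphic to a branch subgroup of $\operatorname{Aut}(\mathcal T_X)$ for some such $X$. Say that the Boone--Higman conjecture is true for a class $\mathcal C$ of groups if every finitely generated group $G$ in $\mathcal C$ has solvable word problem if and only if $G$ embeds into a finitely presented simple group. \textbf{Corollary.} If the Boone--Higman conjecture is true for the class of branch groups that are $\mathrm{EFRF}^{+}$, then it is true for the class of all $\mathrm{EFRF}^{+}$ groups. -/

import Mathlib

universe u

/-! ### Words, the word problem, and effective residual finiteness -/

/-- `s` enumerates a finite symmetric generating set of `G`. -/
structure IsSymmetricGenerating {G : Type u} [Group G] {k : ℕ} (s : Fin k → G) : Prop where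
  closure_eq_top : Subgroup.closure (Set.range s) = ⊤
  inv_mem : ∀ i, ∃ j, s j = (s i)⁻¹

/-- The element of `G` represented by a word over the enumerated generators. -/
def wordEval {G : Type u} [Group G] {k : ℕ} (s : Fin k → G) (w : List (Fin k)) : G :=
  (w.map s).prod

/-- `G` is finitely generated, and for a finite symmetric generating set it is decidable
which words represent the identity. -/
def HasSolvableWordProblem (G : Type u) [Group G] : Prop :=
  ∃ (k : ℕ) (s : Fin k → G), IsSymmetricGenerating s ∧
    ComputablePred fun w : List (Fin k) => wordEval s w = 1

/-- `out = (n, T)` is a finite description of the homomorphism `φ` from `G` to the permutations of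
`{0, …, n - 1}`: for each generator `s i`, `T i` is the list of values of the permutation
`φ (s i)`. -/
def DescribesHom {G : Type u} [Group G] {k : ℕ} (s : Fin k → G)
    (out : ℕ × (Fin k → List ℕ)) (φ : G →* Equiv.Perm (Fin out.1)) : Prop :=
  ∀ i, out.2 i = List.ofFn fun j : Fin out.1 => (φ (s i) j : ℕ)

/-- Effectively residually finite with co-semi-decidable word problem: `G` has a finite symmetric
generating set and an algorithm that halts exactly on the words that represent nontrivial elements,
and on such a word `w` outputs a homomorphism `φ` from `G` onto a finite group `φ.range`
(a group of permutations of a finite set) that does not kill the element represented by `w`. -/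
def IsEFRFPlus (G : Type u) [Group G] : Prop :=
  ∃ (k : ℕ) (s : Fin k → G), IsSymmetricGenerating s ∧
    ∃ M : List (Fin k) →. ℕ × (Fin k → List ℕ), Partrec M ∧
      ∀ w : List (Fin k),
        ((M w).Dom ↔ wordEval s w ≠ 1) ∧
        ∀ out ∈ M w, ∃ φ : G →* Equiv.Perm (Fin out.1),
          DescribesHom s out φ ∧ φ (wordEval s w) ≠ 1

/-! ### Spherically homogeneous rooted trees and branch groups -/

/-- The vertices of the tree of the alphabets `X 0, X 1, …`: a vertex of level `ℓ` is a word
in `X 0 × ⋯ × X (ℓ - 1)`. -/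
def TreeVertex (X : ℕ → Type) : Type := Σ ℓ : ℕ, ((i : Fin ℓ) → X i)

namespace TreeVertex

variable {X : ℕ → Type}

/-- The length of the word `v`. -/
def level (v : TreeVertex X) : ℕ := v.1

/-- The empty word. -/
def root (X : ℕ → Type) : TreeVertex X := ⟨0, fun i => i.elim0⟩

/-- The word `w` starts with the word `v`, that is, `w` is a vertex of the subtree below `v`. -/
def IsPrefix (v w : TreeVertex X) : Prop :=
  ∃ h : v.1 ≤ w.1, ∀ i : Fin v.1, v.2 i = w.2 (Fin.castLE h i)

/-- `w = v x` for a letter `x`. -/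
def IsChild (v w : TreeVertex X) : Prop := w.level = v.level + 1 ∧ IsPrefix v w

end TreeVertex

/-- The spherically homogeneous rooted tree associated to the sequence of alphabets `X`. -/
def rootedTree (X : ℕ → Type) : SimpleGraph (TreeVertex X) :=
  SimpleGraph.fromRel TreeVertex.IsChild

/-- The group of all automorphisms of the tree that fix the root. -/
def rootedAut (X : ℕ → Type) : Subgroup (rootedTree X ≃g rootedTree X) where
  carrier := {g | g (TreeVertex.root X) = TreeVertex.root X}
  one_mem' := rfl
  mul_mem' := by
    intro a b ha hb
    change a (b (TreeVertex.root X)) = TreeVertex.root X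
    rw [Set.mem_ofPred_eq] at ha hb
    rw [hb, ha]
  inv_mem' := by
    intro a ha
    change a.symm (TreeVertex.root X) = TreeVertex.root X
    rw [Set.mem_ofPred_eq] at ha
    exact (RelIso.symm_apply_eq a).2 ha.symm

/-- `B` acts transitively on every level of the tree. -/
def IsSphericallyTransitive {X : ℕ → Type} (B : Subgroup (rootedAut X)) : Prop :=
  ∀ v w : TreeVertex X, v.level = w.level → ∃ g ∈ B, g.1 v = w

/-- The rigid stabilizer of `v` in `B`: the elements of `B` that fix `v` and all vertices outside
of the subtree below `v`. -/
def rigidStabilizer {X : ℕ → Type} (B : Subgroup (rootedAut X)) (v : TreeVertex X) :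
    Subgroup (rootedAut X) where
  carrier := {g | g ∈ B ∧ g.1 v = v ∧ ∀ w, ¬ TreeVertex.IsPrefix v w → g.1 w = w}
  one_mem' := ⟨B.one_mem, rfl, fun _ _ => rfl⟩
  mul_mem' := by
    rintro a b ⟨ha, hav, ha'⟩ ⟨hb, hbv, hb'⟩
    refine ⟨B.mul_mem ha hb, ?_, fun w hw => ?_⟩
    · change a.1 (b.1 v) = v
      rw [hbv, hav]
    · change a.1 (b.1 w) = w
      rw [hb' w hw, ha' w hw]
  inv_mem' := by
    rintro a ⟨ha, hav, ha'⟩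
    refine ⟨B.inv_mem ha, ?_, fun w hw => ?_⟩
    · change a.1.symm v = v
      exact (RelIso.symm_apply_eq a.1).2 hav.symm
    · change a.1.symm w = w
      exact (RelIso.symm_apply_eq a.1).2 (ha' w hw).symm

/-- The rigid level `ℓ` stabilizer: the subgroup generated by the rigid stabilizers of the
vertices of level `ℓ`. -/
def rigidLevelStabilizer {X : ℕ → Type} (B : Subgroup (rootedAut X)) (ℓ : ℕ) :
    Subgroup (rootedAut X) :=
  ⨆ (v : TreeVertex X) (_ : v.level = ℓ), rigidStabilizer B v

/-- `B` is a branch subgroup of the automorphism group of the tree: it acts spherically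
transitively and all its rigid level stabilizers have finite index in it. -/
def IsBranchSubgroup {X : ℕ → Type} (B : Subgroup (rootedAut X)) : Prop :=
  IsSphericallyTransitive B ∧
    ∀ ℓ : ℕ, ((rigidLevelStabilizer B ℓ).subgroupOf B).FiniteIndex

/-- A branch group is a group that is isomorphic to a branch subgroup of the automorphism group of
some spherically homogeneous rooted tree with finite alphabets of at least two letters. -/
def IsBranchGroup (G : Type u) [Group G] : Prop :=
  ∃ X : ℕ → Type, (∀ n, Finite (X n)) ∧ (∀ n, 2 ≤ Nat.card (X n)) ∧
    ∃ B : Subgroup (rootedAut X), IsBranchSubgroup B ∧ Nonempty (G ≃* B)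

/-! ### The Boone–Higman conjecture -/

/-- `G` embeds into a finitely presented simple group. -/
def EmbedsInFinitelyPresentedSimple (G : Type u) [Group G] : Prop :=
  ∃ (H : Type u) (_ : Group H), Group.IsFinitelyPresented H ∧ IsSimpleGroup H ∧
    ∃ f : G →* H, Function.Injective f

/-- The Boone–Higman conjecture is true for the class `C` of groups: a finitely generated group
in `C` has solvable word problem if and only if it embeds into a finitely presented simple group. -/
def BooneHigmanFor (C : (G : Type u) → Group G → Prop) : Prop :=
  ∀ (G : Type u) [inst : Group G], C G inst → Group.FG G →
    (HasSolvableWordProblem G ↔ EmbedsInFinitelyPresentedSimple G)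

/-!
An `EFRF⁺` group has a faithful action on a set of codes in which every element acts computably and
all orbits are finite (`IsEFRFPlus.exists_action`), and a converse of this holds
(`ComputableOrbits.isEFRFPlus`).

If an `EFRF⁺` group embeds into a finitely presented group, its trivial words are recursively
enumerable because finite presentations have recursively enumerable consequences
(`rePred_wordEval_eq_one`), and its nontrivial words are recursively enumerable because the given
algorithm halts exactly on them. Hence its word problem is solvable.

For the converse it suffices to embed an `EFRF⁺` group `G` with solvable word problem into a branch
group that is `EFRF⁺` and has solvable word problem, since the assumption applies to the latter.
This is done in two steps.

* The spinal construction below needs a perfect group. The action `θ` of `G` on `Ω` leads to a group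
  `D` of permutations of `Fin m × Ω`, `5 ≤ m`, generated by the even permutations of the copies of
  `Ω` and the elements that act by `g` on one copy and by `g⁻¹` on another
  (`Wreath.alternatingTwist`). It is perfect, and it contains a diagonal element `(g₁, …, gₘ)` as
  soon as the product of the `gᵢ` lies in the commutator subgroup of `θ.range`. As `G` is finitely
  generated, it has endomorphisms `γ₁, …, γₘ`, one of them the identity, such that `γ₁ g ⋯ γₘ g`
  always lies in the commutator subgroup (`exists_endomorphisms_prod_mem_commutator`), so `G` embeds
  into `D`.

* Let `D` act on a sequence of finite orbits of `Fin m × Ω` that contains each orbit infinitely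
  often. The spinal group (`SpinalSystem.group`) acts on the tree whose alphabets are these orbits.
  It is generated by two copies of `D`: the rooted elements act on the first letter, and the
  directed elements act next to a ray, the spine, by the corresponding action of `D` on each level.
  As `D` is perfect, a commutator trick shows that the spinal group contains its copies below all
  vertices (`SpinalSystem.below_mem`), so it is a branch group. It contains `D` as the group of
  directed elements, because each nontrivial element of `D` acts nontrivially on infinitely many
  alphabets. Its action on the tree is computable, so it is `EFRF⁺`.

The word problem of the spinal group is solvable by contraction
(`SpinalSystem.eval_eq_one_of_level`): the sections of a word at the first level either have fewer
directed letters, or are directed elements of products of letters of the word. Hence a word is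
trivial if it acts trivially up to a level by which all nontrivial products of subwords of its
letters act nontrivially on some alphabet of large enough index. Such a level can be computed,
because the word problem of `D` is solvable and a nontrivial element of `D` moves a point that can
be found by search, whose orbit occurs at arbitrarily large indices.
-/

/-! ### Closure properties of computable functions and predicates -/

namespace Computable

variable {α β σ : Type*} [Primcodable α] [Primcodable β] [Primcodable σ]

theorem list_foldl {f : α → List β} {g : α → σ} {h : α → σ × β → σ} (hf : Computable f)
    (hg : Computable g) (hh : Computable₂ h) :
    Computable fun a => (f a).foldl (fun s b => h a (s, b)) (g a) := by
  -- The fold is a primitive recursion over the position in the list.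
  have key : Computable fun a => Nat.rec (motive := fun _ => σ) (g a)
      (fun n s => Option.casesOn (motive := fun _ => σ) (f a)[n]? s fun b => h a (s, b))
      (f a).length := by
    refine Computable.nat_rec (h := fun a (p : ℕ × σ) =>
      Option.casesOn (motive := fun _ => σ) (f a)[p.1]? p.2 fun b => h a (p.2, b))
      (list_length.comp hf) hg ?_
    refine Computable.option_casesOn
      (list_getElem?.comp (hf.comp fst) (fst.comp snd)) (snd.comp snd) ?_
    exact hh.comp (fst.comp fst) (pair (snd.comp (snd.comp fst)) snd)
  refine key.of_eq fun a => ?_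
  suffices H : ∀ n ≤ (f a).length, Nat.rec (motive := fun _ => σ) (g a)
      (fun n s => Option.casesOn (motive := fun _ => σ) (f a)[n]? s fun b => h a (s, b)) n =
      ((f a).take n).foldl (fun s b => h a (s, b)) (g a) by
    simpa using H _ le_rfl
  intro n hn
  induction n with
  | zero => simp
  | succ n ih =>
    have hlt : n < (f a).length := hn
    rw [List.take_succ_eq_append_getElem hlt, List.foldl_append]
    simp [ih hlt.le, List.getElem?_eq_getElem hlt]

theorem list_foldr {f : α → List β} {g : α → σ} {h : α → β × σ → σ} (hf : Computable f)
    (hg : Computable g) (hh : Computable₂ h) :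
    Computable fun a => (f a).foldr (fun b s => h a (b, s)) (g a) := by
  refine (list_foldl (h := fun a (p : σ × β) => h a (p.2, p.1)) (list_reverse.comp hf) hg
    (hh.comp fst (pair (snd.comp snd) (fst.comp snd)))).of_eq fun a => ?_
  rw [List.foldl_reverse]

theorem list_map {f : α → List β} {g : α → β → σ} (hf : Computable f) (hg : Computable₂ g) :
    Computable fun a => (f a).map (g a) := by
  refine (list_foldr (h := fun a (p : β × List σ) => g a p.1 :: p.2) hf (const [])
    (list_cons.comp (hg.comp fst (fst.comp snd)) (snd.comp snd))).of_eq fun a => ?_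
  induction f a <;> simp_all

theorem list_all {f : α → List β} {g : α → β → Bool} (hf : Computable f) (hg : Computable₂ g) :
    Computable fun a => (f a).all (g a) := by
  refine (list_foldr (h := fun a (p : β × Bool) => g a p.1 && p.2) hf (const true)
    (Primrec.and.to_comp.comp (hg.comp fst (fst.comp snd)) (snd.comp snd))).of_eq fun a => ?_
  induction f a <;> simp_all

end Computable

namespace ComputablePred

variable {α β : Type*} [Primcodable α] [Primcodable β]

theorem comp {p : β → Prop} (hp : ComputablePred p) {f : α → β} (hf : Computable f) :
    ComputablePred fun a => p (f a) := by
  classical exact (hp.decide.comp hf).computablePred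

theorem and {p q : α → Prop} (hp : ComputablePred p) (hq : ComputablePred q) :
    ComputablePred fun a => p a ∧ q a := by
  classical
  exact ((Primrec.and.to_comp.comp hp.decide hq.decide).of_eq fun a => by simp).computablePred

theorem or {p q : α → Prop} (hp : ComputablePred p) (hq : ComputablePred q) :
    ComputablePred fun a => p a ∨ q a := by
  classical
  exact ((Primrec.or.to_comp.comp hp.decide hq.decide).of_eq fun a => by simp).computablePred

theorem forall_mem_list {f : α → List β} (hf : Computable f) {p : α → β → Prop}
    (hp : ComputablePred fun x : α × β => p x.1 x.2) :
    ComputablePred fun a => ∀ b ∈ f a, p a b := by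
  classical
  exact ((Computable.list_all (g := fun a b => decide (p a b)) hf hp.decide).of_eq
    fun a => (by rw [Bool.eq_iff_iff]; simp :
      (f a).all (fun b => decide (p a b)) = decide (∀ b ∈ f a, p a b))).computablePred

theorem exists_mem_list {f : α → List β} (hf : Computable f) {p : α → β → Prop}
    (hp : ComputablePred fun x : α × β => p x.1 x.2) :
    ComputablePred fun a => ∃ b ∈ f a, p a b :=
  (forall_mem_list hf (p := fun a b => ¬ p a b) hp.not).not.of_eq fun a => by simp

theorem forall_fin {n : ℕ} {p : Fin n → α → Prop} (hp : ∀ i, ComputablePred (p i)) :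
    ComputablePred fun a => ∀ i, p i a := by
  classical
  suffices H : ∀ l : List (Fin n), ComputablePred fun a => ∀ i ∈ l, p i a by
    exact (H (List.finRange n)).of_eq fun a => by simp
  intro l
  induction l with
  | nil => exact ((Computable.const true).of_eq fun a => (by simp :
      true = decide (∀ i ∈ ([] : List (Fin n)), p i a))).computablePred
  | cons i l ih => exact ((hp i).and ih).of_eq fun a => by simp

theorem exists_fin {n : ℕ} {p : Fin n → α → Prop} (hp : ∀ i, ComputablePred (p i)) :
    ComputablePred fun a => ∃ i, p i a :=
  (forall_fin fun i => (hp i).not).not.of_eq fun a => by simp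

theorem eq [DecidableEq β] {f g : α → β} (hf : Computable f) (hg : Computable g) :
    ComputablePred fun a => f a = g a := by
  classical
  exact (((Primrec.beq (α := β)).to_comp.comp hf hg).of_eq fun a => by
    simp only [beq_eq_decide]).computablePred

theorem mem_list [DecidableEq β] {f : α → List β} {g : α → β} (hf : Computable f)
    (hg : Computable g) : ComputablePred fun a => g a ∈ f a :=
  (exists_mem_list hf (p := fun a b => b = g a)
    (.eq Computable.snd (hg.comp Computable.fst))).of_eq fun a => by simp

end ComputablePred

theorem Computable.ite_computablePred {α σ : Type*} [Primcodable α] [Primcodable σ] {p : α → Prop}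
    [DecidablePred p] (hp : ComputablePred p) {f g : α → σ} (hf : Computable f)
    (hg : Computable g) : Computable fun a => if p a then f a else g a :=
  (Computable.cond hp.decide hf hg).of_eq fun a => by by_cases h : p a <;> simp [h]

theorem Computable.decode_test {α β : Type*} [Primcodable α] [Primcodable β] {f : α × β → Bool}
    (hf : Computable f) : Computable₂ fun (a : α) (n : ℕ) =>
      ((Encodable.decode n : Option β).map fun b => f (a, b)).getD false := by
  have h1 : Computable fun x : α × ℕ => (Encodable.decode x.2 : Option β) :=
    Computable.decode.comp Computable.snd
  have h2 : Computable₂ fun (x : α × ℕ) (b : β) => f (x.1, b) :=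
    hf.comp (Computable.pair (Computable.fst.comp Computable.fst)
      (Computable.snd (α := α × ℕ) (β := β)))
  have h3 := Computable.option_getD (Computable.option_map h1 h2) (Computable.const false)
  exact h3

/-- Unbounded search over a type of codes. -/
theorem Computable.exists_choice {α β : Type*} [Primcodable α] [Primcodable β] {p : α → β → Prop}
    (hp : ComputablePred fun x : α × β => p x.1 x.2) (h : ∀ a, ∃ b, p a b) :
    ∃ f : α → β, Computable f ∧ ∀ a, p a (f a) := by
  classical
  have hQ : ComputablePred fun x : α × ℕ =>
      (((Encodable.decode x.2 : Option β).map fun b => decide (p x.1 b)).getD false) = true :=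
    ComputablePred.eq (Computable.decode_test hp.decide) (Computable.const true)
  let Q : α → ℕ → Prop := fun a n =>
      (((Encodable.decode n : Option β).map fun b => decide (p a b)).getD false) = true
  have hex : ∀ a, ∃ n, Q a n := fun a => by
    obtain ⟨b, hb⟩ := h a
    exact ⟨Encodable.encode b, by simp [Q, Encodable.encodek, hb]⟩
  have hfind := Computable.find (P := Q) hQ hex
  have hspec : ∀ a, ∃ b, (Encodable.decode (Nat.find (hex a)) : Option β) = some b ∧ p a b := by
    intro a
    have := Nat.find_spec (hex a)
    simp only [Q] at this
    cases hd : (Encodable.decode (Nat.find (hex a)) : Option β) with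
    | none => simp [hd] at this
    | some b => exact ⟨b, rfl, by simpa [hd] using this⟩
  choose f hf using hspec
  refine ⟨f, ?_, fun a => (hf a).2⟩
  rw [← Computable.option_some_iff]
  exact (Computable.decode.comp hfind).of_eq fun a => (hf a).1

theorem REPred.exists_computablePred {α β : Type*} [Primcodable α] [Primcodable β]
    {p : α → β → Prop} (hp : ComputablePred fun x : α × β => p x.1 x.2) :
    REPred fun a => ∃ b, p a b := by
  classical
  refine (Partrec.rfind
    (Computable₂.partrec₂ (Computable.decode_test hp.decide))).dom_re.of_eq fun a => ?_
  rw [Nat.rfind_dom']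
  constructor
  · rintro ⟨n, hn, -⟩
    simp only [PFun.coe_val, Part.mem_some_iff] at hn
    cases hd : (Encodable.decode n : Option β) with
    | none => simp [hd] at hn
    | some b => exact ⟨b, by simpa [hd] using hn⟩
  · rintro ⟨b, hb⟩
    exact ⟨Encodable.encode b, by simp [Encodable.encodek, hb], fun _ => trivial⟩

/-! ### Words over generators -/

theorem wordEval_nil {G : Type u} [Group G] {k : ℕ} (s : Fin k → G) : wordEval s [] = 1 := rfl

theorem wordEval_cons {G : Type u} [Group G] {k : ℕ} (s : Fin k → G) (i : Fin k)
    (w : List (Fin k)) : wordEval s (i :: w) = s i * wordEval s w := rfl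

theorem wordEval_append {G : Type u} [Group G] {k : ℕ} (s : Fin k → G) (v w : List (Fin k)) :
    wordEval s (v ++ w) = wordEval s v * wordEval s w := by
  simp [wordEval]

/-- A symmetric generating set generates the group as a monoid. -/
theorem IsSymmetricGenerating.exists_wordEval {G : Type u} [Group G] {k : ℕ} {s : Fin k → G}
    (hs : IsSymmetricGenerating s) (g : G) : ∃ w, wordEval s w = g := by
  have hg : g ∈ Subgroup.closure (Set.range s) := by rw [hs.closure_eq_top]; trivial
  induction hg using Subgroup.closure_induction_left with
  | one => exact ⟨[], rfl⟩
  | mul_left x hx y _ ih =>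
    obtain ⟨i, rfl⟩ := hx
    obtain ⟨w, rfl⟩ := ih
    exact ⟨i :: w, rfl⟩
  | inv_mul_cancel x hx y _ ih =>
    obtain ⟨i, rfl⟩ := hx
    obtain ⟨w, rfl⟩ := ih
    obtain ⟨j, hj⟩ := hs.inv_mem i
    exact ⟨j :: w, by rw [wordEval_cons, hj]⟩

theorem IsSymmetricGenerating.fg {G : Type u} [Group G] {k : ℕ} {s : Fin k → G}
    (hs : IsSymmetricGenerating s) : Group.FG G :=
  ⟨⟨(Set.finite_range s).toFinset, by simpa using hs.closure_eq_top⟩⟩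

/-- Every finitely generated group has a finite symmetric generating set. -/
theorem exists_isSymmetricGenerating {G : Type u} [Group G] {T : Set G} (hT : T.Finite)
    (hcl : Subgroup.closure T = ⊤) : ∃ (k : ℕ) (s : Fin k → G), IsSymmetricGenerating s := by
  have hfin : (T ∪ T⁻¹).Finite := hT.union hT.inv
  obtain ⟨k, s, hs⟩ := hfin.fin_param
  refine ⟨k, s, ?_, fun i => ?_⟩
  · rw [hs.2, eq_top_iff, ← hcl]
    exact Subgroup.closure_mono Set.subset_union_left
  · have : (s i)⁻¹ ∈ Set.range s := by
      rw [hs.2]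
      have hi : s i ∈ T ∪ T⁻¹ := hs.2 ▸ Set.mem_range_self i
      rcases hi with h | h
      · exact Or.inr (by simpa using h)
      · exact Or.inl h
    exact this

/-! ### Recursive enumerability of the trivial words of a finitely presented group -/

namespace Rewriting

variable {A : Type*}

/-- `v` arises from `u` by replacing a factor `r.1` of `u` by `r.2`, for a rule `r`. -/
def Step (rules : List (List A × List A)) (u v : List A) : Prop :=
  ∃ a b, ∃ r ∈ rules, u = a ++ r.1 ++ b ∧ v = a ++ r.2 ++ b

/-- The instruction `c = ((a, b), i)` applies the `i`-th rule between the prefix `a` and the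
suffix `b`, if this is possible. -/
def applyStep [DecidableEq A] (rules : List (List A × List A)) (w : List A)
    (c : (List A × List A) × ℕ) : List A :=
  if w = c.1.1 ++ (rules.getD c.2 ([], [])).1 ++ c.1.2 then
    c.1.1 ++ (rules.getD c.2 ([], [])).2 ++ c.1.2 else w

theorem reflTransGen_iff_exists_foldl [DecidableEq A] (rules : List (List A × List A))
    (u v : List A) :
    Relation.ReflTransGen (Step rules) u v ↔ ∃ c, List.foldl (applyStep rules) u c = v := by
  constructor
  · intro h
    induction h with
    | refl => exact ⟨[], rfl⟩
    | tail _ h ih =>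
      obtain ⟨c, rfl⟩ := ih
      obtain ⟨a, b, r, hr, h1, rfl⟩ := h
      obtain ⟨i, hi, rfl⟩ := List.getElem_of_mem hr
      refine ⟨c ++ [((a, b), i)], ?_⟩
      rw [List.foldl_append, List.foldl_cons, List.foldl_nil, applyStep,
        List.getD_eq_getElem _ _ hi, if_pos h1]
  · rintro ⟨c, rfl⟩
    induction c using List.reverseRecOn with
    | nil => exact .refl
    | append_singleton c x ih =>
      refine ih.trans ?_
      rw [List.foldl_append, List.foldl_cons, List.foldl_nil]
      generalize List.foldl (applyStep rules) u c = w
      unfold applyStep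
      split_ifs with h
      · by_cases hi : x.2 < rules.length
        · rw [List.getD_eq_getElem _ _ hi] at h ⊢
          exact .single ⟨_, _, _, List.getElem_mem hi, h, rfl⟩
        · rw [List.getD_eq_default _ _ (not_lt.1 hi)] at h ⊢
          rw [← h]
      · exact .refl

theorem rePred_reflTransGen {α : Type*} [Primcodable α] [Primcodable A] [DecidableEq A]
    (rules : List (List A × List A)) {f : α → List A} (hf : Computable f) :
    REPred fun a => Relation.ReflTransGen (Step rules) (f a) [] := by
  refine (REPred.exists_computablePred
    (p := fun a (c : List ((List A × List A) × ℕ)) => List.foldl (applyStep rules) (f a) c = [])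
    (.eq ?_ (.const _))).of_eq fun a => (reflTransGen_iff_exists_foldl ..).symm
  have hr : Primrec fun x : (α × List ((List A × List A) × ℕ)) ×
      (List A × ((List A × List A) × ℕ)) => rules.getD x.2.2.2 ([], []) :=
    (Primrec.list_getD ([], [])).comp (Primrec.const rules)
      (Primrec.snd.comp (Primrec.snd.comp Primrec.snd))
  have h1 := Primrec.fst.comp (Primrec.fst.comp (Primrec.snd.comp (Primrec.snd (α :=
    (α × List ((List A × List A) × ℕ))) (β := (List A × ((List A × List A) × ℕ))))))
  have h2 := Primrec.snd.comp (Primrec.fst.comp (Primrec.snd.comp (Primrec.snd (α :=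
    (α × List ((List A × List A) × ℕ))) (β := (List A × ((List A × List A) × ℕ))))))
  refine Computable.list_foldl (h := fun a x => applyStep rules x.1 x.2) Computable.snd
    (hf.comp Computable.fst) (Primrec.to_comp ?_)
  refine Primrec.ite (Primrec.eq.comp (Primrec.fst.comp Primrec.snd) ?_) ?_
    (Primrec.fst.comp Primrec.snd)
  · exact Primrec.list_append.comp (Primrec.list_append.comp h1 (Primrec.fst.comp hr)) h2
  · exact Primrec.list_append.comp (Primrec.list_append.comp h1 (Primrec.snd.comp hr)) h2

theorem Step.append {rules : List (List A × List A)} {u v : List A} (h : Step rules u v)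
    (a b : List A) : Step rules (a ++ u ++ b) (a ++ v ++ b) := by
  obtain ⟨c, d, r, hr, rfl, rfl⟩ := h
  exact ⟨a ++ c, d ++ b, r, hr, by simp, by simp⟩

theorem reflTransGen_append {rules : List (List A × List A)} {u v : List A}
    (h : Relation.ReflTransGen (Step rules) u v) (a b : List A) :
    Relation.ReflTransGen (Step rules) (a ++ u ++ b) (a ++ v ++ b) := by
  induction h with
  | refl => exact .refl
  | tail _ h ih => exact ih.tail (h.append a b)

/-- The congruence on words generated by a symmetric set of rules. -/
def con (rules : List (List A × List A)) (hsymm : ∀ r ∈ rules, (r.2, r.1) ∈ rules) :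
    Con (FreeMonoid A) where
  r u v := Relation.ReflTransGen (Step rules) u.toList v.toList
  iseqv := by
    refine ⟨fun _ => .refl, fun {u v} h => ?_, fun h h' => h.trans h'⟩
    have : Std.Symm (Step rules) := ⟨?_⟩
    · exact Relation.ReflTransGen.stdSymm.symm _ _ h
    rintro _ _ ⟨a, b, r, hr, rfl, rfl⟩
    exact ⟨a, b, _, hsymm r hr, rfl, rfl⟩
  mul' := by
    intro u u' v v' h h'
    have h1 := reflTransGen_append h [] v.toList
    have h2 := reflTransGen_append h' u'.toList []
    simp only [List.nil_append, List.append_nil] at h1 h2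
    exact h1.trans h2

variable {n : ℕ}

/-- The two-sided rules that cancel a letter with its inverse and delete a relator. -/
noncomputable def groupRules (R : Finset (FreeGroup (Fin n))) :
    List (List (Fin n × Bool) × List (Fin n × Bool)) :=
  let del := (List.finRange n).flatMap (fun i => [[(i, true), (i, false)], [(i, false), (i, true)]])
    ++ R.toList.map FreeGroup.toWord
  del.map (fun u => (u, [])) ++ del.map (fun u => ([], u))

theorem groupRules_symm (R : Finset (FreeGroup (Fin n))) :
    ∀ r ∈ groupRules R, (r.2, r.1) ∈ groupRules R := by
  intro r hr
  simp only [groupRules, List.mem_append, List.mem_map] at hr ⊢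
  rcases hr with ⟨u, hu, rfl⟩ | ⟨u, hu, rfl⟩
  · exact Or.inr ⟨u, hu, rfl⟩
  · exact Or.inl ⟨u, hu, rfl⟩

theorem groupRules_cancel (R : Finset (FreeGroup (Fin n))) (i : Fin n) (b : Bool) :
    ([(i, b), (i, !b)], []) ∈ groupRules R := by
  simp only [groupRules, List.mem_append, List.mem_map]
  refine Or.inl ⟨_, Or.inl (List.mem_flatMap.2 ⟨i, List.mem_finRange i, ?_⟩), rfl⟩
  cases b <;> simp

theorem groupRules_relator {R : Finset (FreeGroup (Fin n))} {r : FreeGroup (Fin n)} (hr : r ∈ R) :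
    (r.toWord, []) ∈ groupRules R := by
  simp only [groupRules, List.mem_append, List.mem_map]
  exact Or.inl ⟨_, Or.inr ⟨r, by simpa using hr, rfl⟩, rfl⟩

theorem mk_eq_of_mem_groupRules {R : Finset (FreeGroup (Fin n))} {N : Subgroup (FreeGroup (Fin n))}
    (hN : ↑R ⊆ (N : Set (FreeGroup (Fin n)))) {r} (hr : r ∈ groupRules R) :
    FreeGroup.mk r.1 ∈ N ∧ FreeGroup.mk r.2 ∈ N := by
  have key : ∀ u, (u ∈ (List.finRange n).flatMap
      (fun i => [[(i, true), (i, false)], [(i, false), (i, true)]]) ∨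
      ∃ a ∈ R.toList, a.toWord = u) → FreeGroup.mk u ∈ N := by
    rintro u (hu | hu)
    · obtain ⟨i, -, hi⟩ := List.mem_flatMap.1 hu
      have : FreeGroup.mk u = 1 := by
        rcases List.mem_pair.1 hi with rfl | rfl
        · exact Quot.sound (FreeGroup.Red.Step.not (L₁ := []) (L₂ := []) (b := true))
        · exact Quot.sound (FreeGroup.Red.Step.not (L₁ := []) (L₂ := []) (b := false))
      rw [this]; exact N.one_mem
    · obtain ⟨r, hr, rfl⟩ := hu
      rw [FreeGroup.mk_toWord]
      exact hN (by simpa using hr)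
  simp only [groupRules, List.mem_append, List.mem_map] at hr
  rcases hr with ⟨u, hu, rfl⟩ | ⟨u, hu, rfl⟩
  · exact ⟨key u hu, N.one_mem⟩
  · exact ⟨N.one_mem, key u hu⟩

theorem mk_mem_iff_of_reflTransGen {R : Finset (FreeGroup (Fin n))}
    {N : Subgroup (FreeGroup (Fin n))} [N.Normal] (hN : ↑R ⊆ (N : Set (FreeGroup (Fin n))))
    {u v : List (Fin n × Bool)} (h : Relation.ReflTransGen (Step (groupRules R)) u v) :
    FreeGroup.mk u ∈ N ↔ FreeGroup.mk v ∈ N := by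
  induction h with
  | refl => rfl
  | tail _ h ih =>
    rw [ih]
    obtain ⟨a, b, r, hr, rfl, rfl⟩ := h
    obtain ⟨h1, h2⟩ := mk_eq_of_mem_groupRules hN hr
    have : ∀ x ∈ N, FreeGroup.mk a * x * FreeGroup.mk b ∈ N ↔
        FreeGroup.mk a * FreeGroup.mk b ∈ N := fun x hx => by
      have hc : FreeGroup.mk a * x * (FreeGroup.mk a)⁻¹ ∈ N :=
        Subgroup.Normal.conj_mem inferInstance x hx _
      rw [← Subgroup.mul_mem_cancel_left N hc (y := FreeGroup.mk a * FreeGroup.mk b)]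
      rw [show FreeGroup.mk a * x * (FreeGroup.mk a)⁻¹ * (FreeGroup.mk a * FreeGroup.mk b) =
        FreeGroup.mk a * x * FreeGroup.mk b by group]
    rw [← FreeGroup.mul_mk, ← FreeGroup.mul_mk, ← FreeGroup.mul_mk, ← FreeGroup.mul_mk,
      this _ h1, this _ h2]

/-- A word lies in the normal closure of `R` if and only if it can be rewritten to the empty word.
The words modulo rewriting form a monoid in which the letters are units, so the free group maps
to it, and the relators are in the kernel. -/
theorem mk_mem_normalClosure_iff (R : Finset (FreeGroup (Fin n))) (u : List (Fin n × Bool)) :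
    FreeGroup.mk u ∈ Subgroup.normalClosure (R : Set (FreeGroup (Fin n))) ↔
      Relation.ReflTransGen (Step (groupRules R)) u [] := by
  constructor
  · intro hu
    let C := con (groupRules R) (groupRules_symm R)
    have hcancel : ∀ i b, ((FreeMonoid.of (i, b) : FreeMonoid (Fin n × Bool)) : C.Quotient) *
        (FreeMonoid.of (i, !b) : FreeMonoid (Fin n × Bool)) = 1 := fun i b => by
      rw [← Con.coe_mul, ← Con.coe_one, Con.eq]
      exact .single ⟨[], [], _, groupRules_cancel R i b, rfl, rfl⟩
    let x : Fin n → C.Quotientˣ := fun i =>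
      ⟨(FreeMonoid.of (i, true) : FreeMonoid (Fin n × Bool)),
        (FreeMonoid.of (i, false) : FreeMonoid (Fin n × Bool)), hcancel i true, hcancel i false⟩
    have hlift : ∀ w : List (Fin n × Bool), ((FreeGroup.lift x (FreeGroup.mk w) : C.Quotientˣ) :
        C.Quotient) = (FreeMonoid.ofList w : FreeMonoid (Fin n × Bool)) := fun w => by
      induction w with
      | nil => rfl
      | cons a w ih =>
        rw [FreeGroup.lift_mk] at ih
        rw [FreeGroup.lift_mk, List.map_cons, List.prod_cons, Units.val_mul, ih,
          FreeMonoid.ofList_cons, Con.coe_mul]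
        congr 1
        obtain ⟨i, b⟩ := a
        cases b <;> rfl
    have hker : Subgroup.normalClosure (R : Set (FreeGroup (Fin n))) ≤ (FreeGroup.lift x).ker := by
      refine Subgroup.normalClosure_le_normal fun r hr => ?_
      rw [SetLike.mem_coe, MonoidHom.mem_ker, ← Units.val_eq_one, ← FreeGroup.mk_toWord (x := r),
        hlift, ← Con.coe_one, Con.eq]
      exact .single ⟨[], [], _, groupRules_relator (by simpa using hr), by simp, rfl⟩
    have h1 := hker hu
    rw [MonoidHom.mem_ker, ← Units.val_eq_one, hlift, ← Con.coe_one, Con.eq] at h1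
    exact h1
  · intro h
    exact (mk_mem_iff_of_reflTransGen Subgroup.subset_normalClosure h).2 (Subgroup.one_mem _)

end Rewriting

theorem rePred_wordEval_eq_one {G : Type u} {H : Type*} [Group G] [Group H]
    (hH : Group.IsFinitelyPresented H) {f : G →* H} (hf : Function.Injective f) {k : ℕ}
    (s : Fin k → G) : REPred fun w : List (Fin k) => wordEval s w = 1 := by
  obtain ⟨n, φ, hφ, R, hR, hker⟩ := hH.out
  have hker' : Subgroup.normalClosure (hR.toFinset : Set (FreeGroup (Fin n))) = φ.ker := by
    simpa using hker
  choose c hc using fun i => hφ (f (s i))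
  refine (Rewriting.rePred_reflTransGen (Rewriting.groupRules hR.toFinset)
    (f := fun w : List (Fin k) => w.flatMap fun i => (c i).toWord) ?_).of_eq fun w => ?_
  · exact (Primrec.list_flatMap Primrec.id
      ((Primrec.dom_finite fun i => (c i).toWord).comp Primrec.snd).to₂).to_comp
  · rw [← Rewriting.mk_mem_normalClosure_iff, hker', MonoidHom.mem_ker, ← hf.eq_iff, map_one]
    suffices φ (FreeGroup.mk (w.flatMap fun i => (c i).toWord)) = f (wordEval s w) by rw [this]
    induction w with
    | nil => rw [wordEval_nil, map_one, List.flatMap_nil, ← FreeGroup.one_eq_mk, map_one]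
    | cons i w ih =>
      rw [List.flatMap_cons, ← FreeGroup.mul_mk, map_mul, ih, FreeGroup.mk_toWord, hc,
        wordEval_cons, map_mul]

/-! ### Effective residual finiteness and computable actions with finite orbits -/

theorem Computable.of_forall_fin {α σ : Type*} [Primcodable α] [Primcodable σ] {k : ℕ}
    {f : Fin k → α → σ} (hf : ∀ i, Computable (f i)) : Computable₂ f := by
  have h : Computable fun x : Fin k × α => (List.Vector.ofFn fun i => f i x.2).get x.1 :=
    Computable.vector_get.comp ((Computable.vector_ofFn hf).comp Computable.snd) Computable.fst
  exact h.of_eq fun x => by simp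

/-- The values of a partial recursive function can be enumerated. -/
theorem Partrec.exists_enumeration {α σ : Type*} [Primcodable α] [Primcodable σ] {M : α →. σ}
    (hM : Partrec M) : ∃ e : ℕ → Option σ, Computable e ∧
      (∀ n o, e n = some o → ∃ a, o ∈ M a) ∧ ∀ a, ∀ o ∈ M a, ∃ n, e n = some o := by
  obtain ⟨c, hc⟩ := Nat.Partrec.Code.exists_code.1 hM
  have hev : ∀ a : α, Nat.Partrec.Code.eval c (Encodable.encode a) = (M a).map Encodable.encode :=
    fun a => by rw [hc]; simp [Encodable.encodek]
  refine ⟨fun n => (Encodable.decode (α := α) n.unpair.1).bind fun a =>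
    (Nat.Partrec.Code.evaln n.unpair.2 c (Encodable.encode a)).bind Encodable.decode, ?_, ?_, ?_⟩
  · refine Computable.option_bind (Computable.decode.comp (Computable.fst.comp Computable.unpair))
      (Computable.option_bind (f := fun p : ℕ × α =>
        Nat.Partrec.Code.evaln p.1.unpair.2 c (Encodable.encode p.2)) ?_
        (Computable.decode.comp Computable.snd))
    exact Nat.Partrec.Code.primrec_evaln.to_comp.comp
      (Computable.pair (Computable.pair (Computable.snd.comp
        (Computable.unpair.comp Computable.fst)) (Computable.const c))
        (Computable.encode.comp Computable.snd))
  · intro n o h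
    obtain ⟨a, -, h⟩ := Option.bind_eq_some_iff.1 h
    obtain ⟨x, hx, ho⟩ := Option.bind_eq_some_iff.1 h
    have := Nat.Partrec.Code.evaln_sound hx
    rw [hev, Part.mem_map_iff] at this
    obtain ⟨o', ho', rfl⟩ := this
    rw [Encodable.encodek, Option.some.injEq] at ho
    exact ⟨a, ho ▸ ho'⟩
  · intro a o ho
    have : Encodable.encode o ∈ Nat.Partrec.Code.eval c (Encodable.encode a) := by
      rw [hev]; exact Part.mem_map _ ho
    obtain ⟨t, ht⟩ := Nat.Partrec.Code.evaln_complete.1 this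
    refine ⟨Nat.pair (Encodable.encode a) t, ?_⟩
    simp only [Nat.unpair_pair, Encodable.encodek, Option.bind_some]
    rw [Option.mem_def.1 ht, Option.bind_some, Encodable.encodek]

/-- An effective form of residual finiteness as a single action: a faithful action on a set of
codes in which every element acts computably and all orbits are finite. -/
structure IsComputableLocallyFiniteAction {G : Type u} [Group G] {V : Type*} [Primcodable V]
    (θ : G →* Equiv.Perm V) : Prop where
  injective : Function.Injective θ
  finite_orbit : ∀ v, (Set.range fun g => θ g v).Finite
  computable : ∀ g, Computable (θ g)

/-- The action combines all finite quotients that the algorithm can output: the `n`-th output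
`(N, T)` acts on the pairs `(n, y)` with `y < N`. -/
theorem IsEFRFPlus.exists_action {G : Type u} [Group G] (h : IsEFRFPlus G) :
    ∃ θ : G →* Equiv.Perm (ℕ × ℕ), IsComputableLocallyFiniteAction θ := by
  obtain ⟨k, s, hs, M, hM, hMw⟩ := h
  obtain ⟨e, he, he1, he2⟩ := hM.exists_enumeration
  have hφ : ∀ o : ℕ × (Fin k → List ℕ), ∃ φ : G →* Equiv.Perm (Fin o.1),
      (∃ n, e n = some o) → DescribesHom s o φ := fun o => by
    by_cases ho : ∃ n, e n = some o
    · obtain ⟨n, hn⟩ := ho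
      obtain ⟨w, hw⟩ := he1 n o hn
      obtain ⟨φ, hφ, -⟩ := (hMw w).2 o hw
      exact ⟨φ, fun _ => hφ⟩
    · exact ⟨1, fun h => absurd h ho⟩
  choose φ hφ using hφ
  -- the permutations of `{0, …, N - 1}` extended by the identity to all natural numbers
  let ψ : ℕ → G →* Equiv.Perm ℕ := fun n => match e n with
    | none => 1
    | some o => (Equiv.Perm.extendDomainHom Fin.equivSubtype).comp (φ o)
  have hψ_some : ∀ n o, e n = some o →
      ψ n = (Equiv.Perm.extendDomainHom Fin.equivSubtype).comp (φ o) := fun n o h => by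
    simp only [ψ, h]
  have hψ_none : ∀ n, e n = none → ψ n = 1 := fun n h => by simp only [ψ, h]
  have hψ_lt : ∀ n o, e n = some o → ∀ g (y : Fin o.1), ψ n g y = φ o g y := fun n o h g y => by
    rw [hψ_some n o h]
    exact Equiv.Perm.extendDomain_apply_image (φ o g) Fin.equivSubtype y
  have hψ_ge : ∀ n o, e n = some o → ∀ g y, o.1 ≤ y → ψ n g y = y := fun n o h g y hy => by
    rw [hψ_some n o h]
    exact Equiv.Perm.extendDomain_apply_not_subtype _ _ (not_lt.2 hy)
  let θ : G →* Equiv.Perm (ℕ × ℕ) :=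
    { toFun := fun g => ⟨fun x => (x.1, ψ x.1 g x.2), fun x => (x.1, ψ x.1 g⁻¹ x.2),
        fun x => by simp, fun x => by simp⟩
      map_one' := by ext x <;> simp
      map_mul' := fun g h => by ext x <;> simp }
  have hθ : ∀ g x, θ g x = (x.1, ψ x.1 g x.2) := fun _ _ => rfl
  refine ⟨θ, ?_, fun x => ?_, fun g => ?_⟩
  · rw [injective_iff_map_eq_one]
    intro g hg
    obtain ⟨w, rfl⟩ := hs.exists_wordEval g
    by_contra hne
    obtain ⟨o, ho⟩ := Part.dom_iff_mem.1 ((hMw w).1.2 hne)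
    obtain ⟨φ', hd, hφ'⟩ := (hMw w).2 o ho
    obtain ⟨n, hn⟩ := he2 w o ho
    -- a homomorphism is determined by the values on the generators
    have hφφ' : φ o = φ' := by
      refine MonoidHom.eq_of_eqOn_dense hs.closure_eq_top ?_
      rintro _ ⟨i, rfl⟩
      have h1 := (hφ o ⟨n, hn⟩ i).symm.trans (hd i)
      ext j
      exact congrFun (List.ofFn_injective h1) j
    apply hφ'
    rw [← hφφ']
    ext y
    have := congrArg (fun f => (f (n, (y : ℕ))).2) hg
    simp only [hθ, hψ_lt n o hn] at this
    simpa using this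
  · cases ho : e x.1 with
    | none =>
      refine (Set.finite_singleton x).subset ?_
      rintro _ ⟨g, rfl⟩
      simp [hθ, hψ_none _ ho]
    | some o =>
      refine ((Set.finite_singleton x.1).prod (Set.finite_Iio (max o.1 (x.2 + 1)))).subset ?_
      rintro _ ⟨g, rfl⟩
      refine ⟨rfl, ?_⟩
      simp only [hθ, Set.mem_Iio, lt_max_iff]
      rcases lt_or_ge x.2 o.1 with hx | hx
      · left
        rw [show x.2 = ((⟨x.2, hx⟩ : Fin o.1) : ℕ) from rfl, hψ_lt _ o ho]
        exact Fin.is_lt _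
      · right
        rw [hψ_ge _ o ho _ _ hx]
        exact Nat.lt_succ_self _
  · obtain ⟨w, rfl⟩ := hs.exists_wordEval g
    induction w with
    | nil => exact Computable.id.of_eq fun x => by simp [wordEval_nil]
    | cons i w ih =>
      suffices hi : Computable (θ (s i)) from
        (hi.comp ih).of_eq fun x => by rw [wordEval_cons, map_mul, Equiv.Perm.mul_apply]
      have hval : Computable fun x : ℕ × ℕ => Option.casesOn (motive := fun _ => ℕ) (e x.1) x.2
          fun o => (o.2 i).getD x.2 x.2 := by
        refine Computable.option_casesOn (he.comp Computable.fst) Computable.snd ?_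
        have h1 : Computable fun p : (ℕ × ℕ) × (ℕ × (Fin k → List ℕ)) => p.2.2 i :=
          Computable.fin_app.comp (Computable.snd.comp Computable.snd) (Computable.const i)
        have h2 : Computable fun p : (ℕ × ℕ) × (ℕ × (Fin k → List ℕ)) => p.1.2 :=
          Computable.snd.comp Computable.fst
        have h3 := Computable.option_getD (Computable.list_getElem?.comp h1 h2) h2
        exact h3.of_eq fun p => by simp
      refine (Computable.pair Computable.fst hval).of_eq fun x => ?_
      rw [hθ]
      cases ho : e x.1 with
      | none => simp [hψ_none _ ho]
      | some o =>
        simp only [hφ o ⟨_, ho⟩ i, Prod.mk.injEq, true_and]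
        rcases lt_or_ge x.2 o.1 with hx | hx
        · rw [List.getD_eq_getElem _ _ (by simpa using hx)]
          have := hψ_lt _ o ho (s i) ⟨x.2, hx⟩
          simpa using this.symm
        · rw [List.getD_eq_default _ _ (by simpa using hx), hψ_ge _ o ho _ _ hx]

/-- A group acting on a set of codes, with a computable sequence of base points with finite orbits
on which the generators act by the computable functions `raw i`. Outside of these orbits
the functions `raw i` need not be related to the action. -/
structure ComputableOrbits {Γ : Type u} [Group Γ] {k : ℕ} (s : Fin k → Γ) {V : Type*}
    [Primcodable V] (ρ : Γ →* Equiv.Perm V) (base : ℕ → V) (raw : Fin k → V → V) : Prop where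
  isSymmetricGenerating : IsSymmetricGenerating s
  computable_base : Computable base
  computable_raw : ∀ i, Computable (raw i)
  raw_eq : ∀ n i g, raw i (ρ g (base n)) = ρ (s i) (ρ g (base n))
  finite_orbit : ∀ n, (Set.range fun g => ρ g (base n)).Finite

namespace ComputableOrbits

variable {Γ : Type u} [Group Γ] {k : ℕ} {s : Fin k → Γ} {V : Type*} [Primcodable V]
  {ρ : Γ →* Equiv.Perm V} {base : ℕ → V} {raw : Fin k → V → V}

theorem foldr_raw (h : ComputableOrbits s ρ base raw) (n : ℕ) (g : Γ) (w : List (Fin k)) :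
    w.foldr raw (ρ g (base n)) = ρ (wordEval s w) (ρ g (base n)) := by
  induction w with
  | nil => simp [wordEval_nil]
  | cons i w ih =>
    rw [List.foldr_cons, ih, wordEval_cons, map_mul, Equiv.Perm.mul_apply,
      ← Equiv.Perm.mul_apply, ← map_mul, h.raw_eq]

theorem computable_foldr (h : ComputableOrbits s ρ base raw) {α : Type*} [Primcodable α]
    {f : α → List (Fin k)} {g : α → V} (hf : Computable f) (hg : Computable g) :
    Computable fun a => (f a).foldr raw (g a) :=
  Computable.list_foldr (h := fun _ (p : Fin k × V) => raw p.1 p.2) hf hg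
    ((Computable.of_forall_fin h.computable_raw).comp (Computable.fst.comp Computable.snd)
      (Computable.snd.comp Computable.snd))

/-- The orbits of the base points are computable: search for a list of words whose values
at the base point form a set that contains the base point and is closed under the generators. -/
theorem exists_orbit_list (h : ComputableOrbits s ρ base raw) : ∃ orb : ℕ → List V,
    Computable orb ∧ ∀ n v, v ∈ orb n ↔ v ∈ Set.range fun g => ρ g (base n) := by
  classical
  let cand : ℕ × List (List (Fin k)) → List V := fun x => x.2.map fun w => w.foldr raw (base x.1)
  have hcand : Computable cand :=
    Computable.list_map Computable.snd (h.computable_foldr Computable.snd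
      (h.computable_base.comp (Computable.fst.comp Computable.fst)))
  have hP : ComputablePred fun x : ℕ × List (List (Fin k)) =>
      base x.1 ∈ cand x ∧ ∀ v ∈ cand x, ∀ i, raw i v ∈ cand x := by
    refine (ComputablePred.mem_list hcand (h.computable_base.comp Computable.fst)).and
      (ComputablePred.forall_mem_list hcand (p := fun x v => ∀ i, raw i v ∈ cand x)
        (ComputablePred.forall_fin fun i => ?_))
    exact ComputablePred.mem_list (hcand.comp Computable.fst)
      ((h.computable_raw i).comp Computable.snd)
  have hbase : ∀ n w, w.foldr raw (base n) = ρ (wordEval s w) (base n) := fun n w => by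
    simpa using h.foldr_raw n 1 w
  obtain ⟨ws, hws, hspec⟩ := Computable.exists_choice
    (p := fun n ws => base n ∈ cand (n, ws) ∧ ∀ v ∈ cand (n, ws), ∀ i, raw i v ∈ cand (n, ws))
    hP fun n => by
      choose c hc using fun g => h.isSymmetricGenerating.exists_wordEval g
      have hex : ∀ v : V, ∃ w : List (Fin k),
          v ∈ Set.range (fun g => ρ g (base n)) → w.foldr raw (base n) = v := fun v => by
          by_cases hv : v ∈ Set.range (fun g => ρ g (base n))
          · obtain ⟨g, rfl⟩ := hv
            exact ⟨c g, fun _ => by rw [hbase, hc]⟩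
          · exact ⟨[], fun h => absurd h hv⟩
      choose d hd using hex
      have hmem : ∀ v, v ∈ cand (n, (h.finite_orbit n).toFinset.toList.map d) ↔
          v ∈ Set.range (fun g => ρ g (base n)) := fun v => by
        simp only [cand, List.map_map, List.mem_map, Finset.mem_toList, Set.Finite.mem_toFinset,
          Function.comp_apply]
        constructor
        · rintro ⟨v', hv', rfl⟩
          rw [hd v' hv']; exact hv'
        · intro hv
          exact ⟨v, hv, hd v hv⟩
      refine ⟨(h.finite_orbit n).toFinset.toList.map d, (hmem _).2 ⟨1, by simp⟩, ?_⟩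
      intro v hv i
      obtain ⟨g, rfl⟩ := (hmem v).1 hv
      exact (hmem _).2 ⟨s i * g, by simp [h.raw_eq]⟩
  refine ⟨fun n => cand (n, ws n), hcand.comp (Computable.pair Computable.id hws), fun n v => ?_⟩
  constructor
  · intro hv
    obtain ⟨w, -, rfl⟩ := List.mem_map.1 hv
    exact ⟨wordEval s w, (hbase n w).symm⟩
  · rintro ⟨g, rfl⟩
    obtain ⟨w, rfl⟩ := h.isSymmetricGenerating.exists_wordEval g
    change ρ _ _ ∈ _
    rw [← hbase]
    induction w with
    | nil => exact (hspec n).1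
    | cons i w ih => exact (hspec n).2 _ ih i

/-- It is decidable whether a word acts trivially on the orbit of a base point. -/
theorem computablePred_forall_orbit (h : ComputableOrbits s ρ base raw) :
    ComputablePred fun x : List (Fin k) × ℕ =>
      ∀ g, ρ (wordEval s x.1) (ρ g (base x.2)) = ρ g (base x.2) := by
  classical
  obtain ⟨orb, horb, hmem⟩ := h.exists_orbit_list
  refine (ComputablePred.forall_mem_list (horb.comp Computable.snd)
    (p := fun (x : List (Fin k) × ℕ) v => x.1.foldr raw v = v)
    (.eq (h.computable_foldr (Computable.fst.comp Computable.fst) Computable.snd)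
      Computable.snd)).of_eq fun x => ?_
  constructor
  · intro H g
    rw [← h.foldr_raw]
    exact H _ ((hmem _ _).2 ⟨g, rfl⟩)
  · intro H v hv
    obtain ⟨g, rfl⟩ := (hmem _ _).1 hv
    exact (h.foldr_raw _ _ _).trans (H g)

/-- The permutation groups that the generators induce on the orbits of the base points can be
computed. Points are replaced by their codes, and codes outside of the orbit are fixed. -/
theorem exists_computable_description (h : ComputableOrbits s ρ base raw) :
    ∃ T : ℕ → ℕ × (Fin k → List ℕ), Computable T ∧ ∀ n, ∃ φ : Γ →* Equiv.Perm (Fin (T n).1),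
      DescribesHom s (T n) φ ∧ ∀ g, φ g = 1 → ∀ x, ρ g (ρ x (base n)) = ρ x (base n) := by
  classical
  obtain ⟨orb, horb, hmem⟩ := h.exists_orbit_list
  let bound : List V → ℕ := fun l => l.foldr (fun v m => max (Encodable.encode v + 1) m) 0
  have hbound : ∀ l, ∀ v ∈ l, Encodable.encode v < bound l := fun l => by
    induction l with
    | nil => simp
    | cons a l ih =>
      intro v hv
      simp only [bound, List.foldr_cons, lt_max_iff]
      rcases List.mem_cons.1 hv with rfl | hv
      · exact Or.inl (Nat.lt_succ_self _)
      · exact Or.inr (ih v hv)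
  let val : Fin k → ℕ × ℕ → ℕ := fun i x =>
    (orb x.1).foldr (fun v r => if Encodable.encode v = x.2 then Encodable.encode (raw i v) else r)
      x.2
  have hval_mem : ∀ i n v, v ∈ orb n →
      val i (n, Encodable.encode v) = Encodable.encode (raw i v) := fun i n v => by
    simp only [val]
    induction orb n with
    | nil => simp
    | cons a l ih =>
      intro hv
      rw [List.foldr_cons]
      split_ifs with ha
      · rw [Encodable.encode_injective ha]
      · refine ih ((List.mem_cons.1 hv).resolve_left ?_)
        rintro rfl
        exact ha rfl
  have hval_not : ∀ i n c, (∀ v ∈ orb n, Encodable.encode v ≠ c) → val i (n, c) = c :=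
    fun i n c => by
      simp only [val]
      induction orb n with
      | nil => simp
      | cons a l ih =>
        intro hv
        rw [List.foldr_cons, if_neg (hv a (by simp))]
        exact ih fun v hvl => hv v (by simp [hvl])
  have hval : ∀ i, Computable (val i) := fun i => by
    refine Computable.list_foldr (h := fun (x : ℕ × ℕ) (p : V × ℕ) =>
      if Encodable.encode p.1 = x.2 then Encodable.encode (raw i p.1) else p.2)
      (horb.comp Computable.fst) Computable.snd ?_
    refine Computable.ite_computablePred (.eq
      (Computable.encode.comp (Computable.fst.comp Computable.snd))
      (Computable.snd.comp Computable.fst)) ?_ (Computable.snd.comp Computable.snd)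
    exact Computable.encode.comp
      ((h.computable_raw i).comp (Computable.fst.comp Computable.snd))
  have hN : Computable fun n => bound (orb n) := by
    refine Computable.list_foldr (h := fun _ (p : V × ℕ) => max (Encodable.encode p.1 + 1) p.2)
      horb (Computable.const 0) ?_
    exact Primrec.nat_max.to_comp.comp
      (Computable.succ.comp (Computable.encode.comp (Computable.fst.comp Computable.snd)))
      (Computable.snd.comp Computable.snd)
  refine ⟨fun n => (bound (orb n), fun i => (List.range (bound (orb n))).map fun c => val i (n, c)),
    Computable.pair hN ?_, fun n => ?_⟩
  · have hlist : ∀ i, Computable fun n => (List.range (bound (orb n))).map fun c => val i (n, c) :=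
      fun i => Computable.list_map (Primrec.list_range.to_comp.comp hN) (hval i)
    have h2 := Computable.vector_ofFn hlist
    refine (Primrec.vector_get'.to_comp.comp h2).of_eq fun n => ?_
    funext i
    simp
  · let : MulAction Γ V := MulAction.compHom V ρ
    let O := MulAction.orbit Γ (base n)
    have hO : ∀ v : O, (v : V) ∈ orb n := fun v => (hmem _ _).2 v.2
    let ι : O → Fin (bound (orb n)) := fun v => ⟨Encodable.encode (v : V), hbound _ _ (hO v)⟩
    have hι : Function.Injective ι := fun v w hvw =>
      Subtype.ext (Encodable.encode_injective (Fin.mk.inj_iff.1 hvw))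
    let e : O ≃ {x // x ∈ Set.range ι} := Equiv.ofInjective ι hι
    refine ⟨(Equiv.Perm.extendDomainHom e).comp (MulAction.toPermHom Γ O), fun i => ?_, ?_⟩
    · apply List.ext_getElem
      · simp
      · intro c hc hc'
        simp only [List.getElem_map, List.getElem_range, List.getElem_ofFn]
        have hc2 : c < bound (orb n) := by simpa using hc
        by_cases hx : (⟨c, hc2⟩ : Fin (bound (orb n))) ∈ Set.range ι
        · obtain ⟨v, hv⟩ := hx
          have h1 := Equiv.Perm.extendDomain_apply_image (MulAction.toPermHom Γ O (s i)) e v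
          have h2 : ((e v : {x // x ∈ Set.range ι}) : Fin _) = ⟨c, hc2⟩ := hv
          rw [h2] at h1
          have hcv : c = Encodable.encode (v : V) := (Fin.mk.inj_iff.1 hv).symm
          refine Eq.trans ?_ (congrArg Fin.val h1).symm
          obtain ⟨g, hg⟩ := v.2
          have hg' : ρ g (base n) = v := hg
          rw [hcv, hval_mem i n v (hO v), ← hg', h.raw_eq, hg']
          rfl
        · have h1 := Equiv.Perm.extendDomain_apply_not_subtype
            (MulAction.toPermHom Γ O (s i)) e hx
          refine Eq.trans ?_ (congrArg Fin.val h1).symm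
          refine hval_not i n c fun v hv hvc => hx ⟨⟨v, (hmem _ _).1 hv⟩, ?_⟩
          exact Fin.ext hvc
    · intro g hg x
      have h1 : MulAction.toPermHom Γ O g = 1 := by
        apply Equiv.Perm.extendDomainHom_injective e
        rw [map_one]
        exact hg
      have h2 := congrArg (fun f => ((f (⟨ρ x (base n), x, rfl⟩ : O) : O) : V)) h1
      exact h2

/-- If the action on the orbits of the base points is faithful, the algorithm searches for an orbit
on which the given word acts nontrivially, and outputs the action on it. -/
theorem isEFRFPlus (h : ComputableOrbits s ρ base raw)
    (hfaithful : ∀ g, (∀ n x, ρ g (ρ x (base n)) = ρ x (base n)) → g = 1) : IsEFRFPlus Γ := by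
  classical
  obtain ⟨T, hT, hφ⟩ := h.exists_computable_description
  have hP := h.computablePred_forall_orbit.not.decide
  let p : List (Fin k) → ℕ → Bool := fun w n =>
    decide (¬ ∀ g, ρ (wordEval s w) (ρ g (base n)) = ρ g (base n))
  have hp : Computable₂ p := hP
  have hspec : ∀ w n, n ∈ Nat.rfind (p w : ℕ →. Bool) → wordEval s w ≠ 1 ∧
      ∀ φ : Γ →* Equiv.Perm (Fin (T n).1), DescribesHom s (T n) φ →
        φ (wordEval s w) ≠ 1 := fun w n hn => by
    have h1 := Nat.rfind_spec hn
    have h1' : p w n = true := by simpa using h1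
    have h2 := of_decide_eq_true h1'
    refine ⟨fun h1 => h2 fun g => by simp [h1], fun φ hd h3 => h2 ?_⟩
    obtain ⟨φ', hd', hφ'⟩ := hφ n
    have : φ = φ' := by
      refine MonoidHom.eq_of_eqOn_dense h.isSymmetricGenerating.closure_eq_top ?_
      rintro _ ⟨i, rfl⟩
      ext j
      exact congrFun (List.ofFn_injective ((hd i).symm.trans (hd' i))) j
    exact hφ' _ (this ▸ h3)
  refine ⟨k, s, h.isSymmetricGenerating, fun w => (Nat.rfind (p w : ℕ →. Bool)).map T,
    (Partrec.rfind hp.partrec₂).map (hT.comp Computable.snd),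
    fun w => ⟨⟨fun hd => ?_, fun hne => ?_⟩,
      fun out hout => ?_⟩⟩
  · exact (hspec w _ (Part.get_mem (o := Nat.rfind (p w : ℕ →. Bool)) hd)).1
  · change (Nat.rfind (p w : ℕ →. Bool)).Dom
    rw [Nat.rfind_dom']
    by_contra hno
    refine hne (hfaithful _ fun n => ?_)
    by_contra hn
    exact hno ⟨n, by simpa [p] using hn, fun _ => trivial⟩
  · obtain ⟨n, hn, rfl⟩ := (Part.mem_map_iff _).1 hout
    obtain ⟨φ, hd, -⟩ := hφ n
    exact ⟨φ, hd, (hspec w n hn).2 φ hd⟩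

end ComputableOrbits

/-! ### Endomorphisms with trivial product in the abelianization -/

/-- For a finitely generated group `G`, finitely many endomorphisms of `G`, the identity among them,
have trivial product modulo the commutator subgroup. Write the abelianization as `ℤʳ × T` with
`T` finite of order `N` and lift the basis of `ℤʳ` to `t₁, …, tᵣ`. The endomorphisms are
`N` copies of the identity, the maps `g ↦ t_c ^ (- N π_c(g))`, where `π_c` is the `c`-th coordinate
of `ℤʳ`, and five trivial ones that only ensure `5 ≤ m`. -/
theorem exists_endomorphisms_prod_mem_commutator (G : Type u) [Group G] [Group.FG G] :
    ∃ (m : ℕ) (γ : Fin m → G →* G), 5 ≤ m ∧ (∃ j, γ j = MonoidHom.id G) ∧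
      ∀ g, (List.ofFn fun j => γ j g).prod ∈ commutator G := by
  classical
  have : Group.FG (Abelianization G) :=
    Group.fg_of_surjective (f := Abelianization.of) (QuotientGroup.mk'_surjective _)
  obtain ⟨ι, κ, _, _, p, hp, e, ⟨E⟩⟩ :=
    CommGroup.equiv_free_prod_prod_multiplicative_zmod (Abelianization G)
  have : ∀ i, NeZero (p i ^ e i) := fun i => ⟨pow_ne_zero _ (hp i).ne_zero⟩
  let T := (i : ι) → Multiplicative (ZMod (p i ^ e i))
  have : Finite T := inferInstanceAs (Finite ((i : ι) → Multiplicative (ZMod (p i ^ e i))))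
  let N := Nat.card T
  have hN : 0 < N := Nat.card_pos
  let π : κ → G →* Multiplicative ℤ := fun c =>
    (Pi.evalMonoidHom _ c).comp ((MonoidHom.fst (κ → Multiplicative ℤ) T).comp
      (E.toMonoidHom.comp Abelianization.of))
  have hπ : ∀ c g, π c g = (E (Abelianization.of g)).1 c := fun _ _ => rfl
  have hlift : ∀ c : κ, ∃ t : G, E (Abelianization.of t) =
      (Pi.mulSingle c (Multiplicative.ofAdd (1 : ℤ)), 1) := fun c => by
    obtain ⟨t, ht⟩ := QuotientGroup.mk'_surjective (commutator G)
      (E.symm (Pi.mulSingle c (Multiplicative.ofAdd (1 : ℤ)), 1))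
    exact ⟨t, (congrArg E ht).trans (E.apply_symm_apply _)⟩
  choose t ht using hlift
  let β : κ → G →* G := fun c => (zpowersHom G (t c)).comp ((zpowGroupHom (-(N : ℤ))).comp (π c))
  have hβ : ∀ c g, E (Abelianization.of (β c g)) = (Pi.mulSingle c ((π c g) ^ (-(N : ℤ))), 1) :=
    fun c g => by
      have : β c g = t c ^ Multiplicative.toAdd ((π c g) ^ (-(N : ℤ))) := rfl
      rw [this, map_zpow, map_zpow, ht, Prod.pow_mk, one_zpow, ← Pi.mulSingle_zpow]
      congr 2
      apply Multiplicative.toAdd.injective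
      simp
  let I := Fin N ⊕ κ ⊕ Fin 5
  let γ' : I → G →* G := Sum.elim (fun _ => MonoidHom.id G) (Sum.elim β fun _ => 1)
  let eqv : Fin (Fintype.card I) ≃ I := (Fintype.equivFin I).symm
  refine ⟨Fintype.card I, γ' ∘ eqv, ?_, ⟨eqv.symm (Sum.inl ⟨0, hN⟩), ?_⟩, fun g => ?_⟩
  · simp only [I, Fintype.card_sum, Fintype.card_fin]
    omega
  · simp [γ']
  · have hker : ∀ x : G, Abelianization.of x = 1 → x ∈ commutator G := fun x hx => by
      rw [← Abelianization.ker_of]; exact hx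
    apply hker
    apply E.injective
    rw [map_list_prod, List.map_ofFn, List.prod_ofFn, map_one]
    have h1 : ∏ j, (Abelianization.of ∘ fun j => (γ' ∘ eqv) j g) j =
        ∏ i, Abelianization.of (γ' i g) :=
      Equiv.prod_comp eqv fun i => Abelianization.of (γ' i g)
    rw [h1, Fintype.prod_sum_type, Fintype.prod_sum_type]
    simp only [γ', Sum.elim_inl, Sum.elim_inr, MonoidHom.id_apply, Finset.prod_const,
      MonoidHom.one_apply, map_one, Finset.card_univ, Fintype.card_fin, mul_one, one_pow, map_mul,
      map_pow, map_prod, hβ]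
    refine Prod.ext ?_ ?_
    · funext c
      rw [Prod.fst_mul, Prod.fst_prod, Pi.mul_apply, Finset.prod_apply, Prod.pow_fst, Pi.pow_apply,
        Finset.prod_eq_single c]
      · change _ * (Pi.mulSingle c ((π c g) ^ (-(N : ℤ))) : κ → Multiplicative ℤ) c = 1
        rw [Pi.mulSingle_eq_same, hπ, zpow_neg, zpow_natCast, mul_inv_cancel]
      · intro b _ hb
        exact Pi.mulSingle_eq_of_ne hb.symm _
      · simp
    · rw [Prod.snd_mul, Prod.snd_prod, Prod.pow_snd]
      simp only [Finset.prod_const_one, mul_one]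
      exact pow_card_eq_one'

/-! ### A perfect group that contains a given permutation group -/

theorem Finset.exists_notMem_of_card_lt {J : Type*} [Fintype J] {s : Finset J}
    (h : s.card < Fintype.card J) : ∃ a, a ∉ s := by
  by_contra! H
  rw [Finset.eq_univ_of_forall H, Finset.card_univ] at h
  exact lt_irrefl _ h

namespace Wreath

open Equiv
open scoped commutatorElement

variable {J : Type*} {Ω : Type*}

/-- The action of the base group of the wreath product of `Perm Ω` with `Perm J` on `J × Ω`. -/
def diag : (J → Perm Ω) →* Perm (J × Ω) where
  toFun f := ⟨fun x => (x.1, f x.1 x.2), fun x => (x.1, (f x.1)⁻¹ x.2), fun x => by simp,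
    fun x => by simp⟩
  map_one' := rfl
  map_mul' _ _ := rfl

theorem diag_apply (f : J → Perm Ω) (x : J × Ω) : diag f x = (x.1, f x.1 x.2) := rfl

/-- The permutation of the copies of `Ω`. -/
def permute : Perm J →* Perm (J × Ω) where
  toFun σ := σ.prodCongr (Equiv.refl Ω)
  map_one' := rfl
  map_mul' _ _ := rfl

theorem permute_apply (σ : Perm J) (x : J × Ω) : permute σ x = (σ x.1, x.2) := rfl

variable [DecidableEq J]

/-- The permutation `g` of the copy of `Ω` with index `j`. -/
def single (j : J) : Perm Ω →* Perm (J × Ω) :=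
  diag.comp (MonoidHom.mulSingle (fun _ : J => Perm Ω) j)

theorem single_apply_same (j : J) (g : Perm Ω) (y : Ω) : single j g (j, y) = (j, g y) := by
  simp [single, diag_apply]

theorem single_apply_of_ne {i j : J} (h : i ≠ j) (g : Perm Ω) (y : Ω) :
    single j g (i, y) = (i, y) := by
  simp [single, diag_apply, h]

theorem single_commute {i j : J} (h : i ≠ j) (g g' : Perm Ω) :
    Commute (single i g) (single j g') :=
  (Pi.mulSingle_commute (f := fun _ : J => Perm Ω) h g g').map diag

theorem permute_mul_single (σ : Perm J) (j : J) (g : Perm Ω) :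
    permute σ * single j g = single (σ j) g * permute σ := by
  refine Equiv.ext fun ⟨i, y⟩ => ?_
  rw [Perm.mul_apply, Perm.mul_apply, permute_apply]
  by_cases h : i = j
  · subst h
    rw [single_apply_same, permute_apply, single_apply_same]
  · rw [single_apply_of_ne h, permute_apply, single_apply_of_ne (σ.injective.ne h)]

theorem permute_conj_single (σ : Perm J) (j : J) (g : Perm Ω) :
    permute σ * single j g * (permute σ)⁻¹ = single (σ j) g := by
  rw [permute_mul_single, mul_inv_cancel_right]

/-- The permutation `g` on the copy `a` of `Ω` and `g⁻¹` on the copy `b`. -/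
def twist (a b : J) (g : Perm Ω) : Perm (J × Ω) := single a g * (single b g)⁻¹

theorem permute_conj_twist (σ : Perm J) (a b : J) (g : Perm Ω) :
    permute σ * twist a b g * (permute σ)⁻¹ = twist (σ a) (σ b) g := by
  rw [twist, twist, ← permute_conj_single σ a, ← permute_conj_single σ b]
  group

theorem prod_mulSingle (f : J → Perm Ω) (l : List J) (hl : l.Nodup) (i : J) :
    (l.map fun j => (Pi.mulSingle j (f j) : J → Perm Ω)).prod i = if i ∈ l then f i else 1 := by
  induction l with
  | nil => rfl
  | cons j l ih =>
    rw [List.map_cons, List.prod_cons, Pi.mul_apply, ih hl.of_cons]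
    by_cases hij : i = j
    · subst hij
      simp [(List.nodup_cons.1 hl).1]
    · simp [hij]

variable [Fintype J]

/-- Generators for `alternatingTwist`. -/
def generators (J : Type*) [DecidableEq J] [Fintype J] (S : Set (Perm Ω)) : Set (Perm (J × Ω)) :=
  permute '' (alternatingGroup J : Set (Perm J)) ∪
    {x | ∃ a b, ∃ g ∈ S, a ≠ b ∧ twist a b g = x}

/-- The subgroup of the wreath product of `closure S` with the alternating group of `J` that
consists of the elements whose base component has trivial product in the abelianization of
`closure S`, given by generators. -/
def alternatingTwist (J : Type*) [DecidableEq J] [Fintype J] (S : Set (Perm Ω)) :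
    Subgroup (Perm (J × Ω)) := Subgroup.closure (generators J S)

variable {S : Set (Perm Ω)}

theorem permute_mem {σ : Perm J} (hσ : σ ∈ alternatingGroup J) :
    permute σ ∈ alternatingTwist J S :=
  Subgroup.subset_closure (Or.inl ⟨σ, hσ, rfl⟩)

theorem finite_generators (hS : S.Finite) : (generators J S).Finite := by
  refine ((Set.toFinite _).image _).union ?_
  refine ((Set.toFinite (Set.univ : Set (J × J))).prod hS).image
    (fun x => twist x.1.1 x.1.2 x.2) |>.subset ?_
  rintro _ ⟨a, b, g, hg, -, rfl⟩
  exact ⟨((a, b), g), ⟨trivial, hg⟩, rfl⟩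

theorem swap_mul_swap_mem {a b c : J} (hab : a ≠ b) (hac : a ≠ c) :
    swap a b * swap a c ∈ alternatingGroup J := by
  rw [Perm.mem_alternatingGroup, map_mul, Perm.sign_swap hab, Perm.sign_swap hac]
  rfl

theorem exists_ne_of_card {a b c : J} (hJ : 5 ≤ Fintype.card J) : ∃ d, d ≠ a ∧ d ≠ b ∧ d ≠ c := by
  obtain ⟨d, hd⟩ := Finset.exists_notMem_of_card_lt (J := J) (s := {a, b, c})
    ((Finset.card_le_three).trans_lt (by omega))
  exact ⟨d, by simpa using hd⟩

/-- Elements `twist a b (g * h)` arise from `twist a b g` and a conjugate of `twist a b h`, where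
the conjugator may act on a third copy of `Ω`. -/
theorem twist_mem (hJ : 5 ≤ Fintype.card J) {g : Perm Ω} (hg : g ∈ Subgroup.closure S) {a b : J}
    (hab : a ≠ b) : twist a b g ∈ alternatingTwist J S := by
  induction hg using Subgroup.closure_induction generalizing a b with
  | mem g hg => exact Subgroup.subset_closure (Or.inr ⟨a, b, g, hg, hab, rfl⟩)
  | one => simp [twist]
  | inv g _ ih =>
    have : twist a b g⁻¹ = twist b a g := by
      rw [twist, twist, map_inv, map_inv, inv_inv, ← map_inv, ((single_commute hab _ _).eq)]
    rw [this]
    exact ih hab.symm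
  | mul g h _ _ ihg ihh =>
    obtain ⟨c, hca, hcb, -⟩ := exists_ne_of_card (a := a) (b := b) (c := b) hJ
    have key : twist a b (g * h) = twist a b g * (twist b c g * twist a b h * (twist b c g)⁻¹) := by
      have h1 : single b g * single a h = single a h * single b g := single_commute hab.symm _ _
      have h2 : Commute ((single c g)⁻¹ : Perm (J × Ω)) (single a h) :=
        (single_commute hca g h).inv_left
      have h3 : Commute ((single c g)⁻¹ : Perm (J × Ω)) ((single b h)⁻¹) :=
        (single_commute hcb g h).inv_inv
      have h4 := h2.mul_right h3
      simp only [twist, map_mul, mul_inv_rev, inv_inv]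
      calc single a g * single a h * ((single b h)⁻¹ * (single b g)⁻¹)
          = single a g * (single b g)⁻¹ * (single b g * single a h) *
            ((single b h)⁻¹ * (single b g)⁻¹) := by group
        _ = single a g * (single b g)⁻¹ * (single b g *
            (single a h * (single b h)⁻¹) * (single b g)⁻¹) := by group
        _ = single a g * (single b g)⁻¹ * (single b g *
            ((single c g)⁻¹ * (single a h * (single b h)⁻¹) * single c g) *
              (single b g)⁻¹) := by rw [h4.eq]; group
        _ = _ := by group
    rw [key]
    have hbc := ihg hcb.symm
    exact mul_mem (ihg hab) (mul_mem (mul_mem hbc (ihh hab)) (inv_mem hbc))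

theorem commutator_alternatingTwist_eq_top (hJ : 5 ≤ Fintype.card J) :
    commutator (alternatingTwist J S) = ⊤ := by
  have hle : alternatingTwist J S ≤ ⁅alternatingTwist J S, alternatingTwist J S⁆ := by
    refine (Subgroup.closure_le _).2 ?_
    rintro _ (⟨σ, hσ, rfl⟩ | ⟨a, b, g, hg, hab, rfl⟩)
    · have h1 : ⁅alternatingGroup J, alternatingGroup J⁆ = alternatingGroup J := by
        rw [← Subgroup.map_subtype_commutator, commutator_alternatingGroup_eq_top
          (by rwa [Nat.card_eq_fintype_card]), ← MonoidHom.range_eq_map, Subgroup.range_subtype]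
      have h2 : (alternatingGroup J).map permute ≤ alternatingTwist J S := by
        rintro _ ⟨τ, hτ, rfl⟩
        exact permute_mem hτ
      refine Subgroup.commutator_mono h2 h2 ?_
      rw [← Subgroup.map_commutator, h1]
      exact ⟨σ, hσ, rfl⟩
    · obtain ⟨c, hca, hcb, -⟩ := exists_ne_of_card (a := a) (b := b) (c := b) hJ
      obtain ⟨e, hea, heb, hec⟩ := exists_ne_of_card (a := a) (b := b) (c := c) hJ
      have hσ := swap_mul_swap_mem (J := J) hab hea.symm
      have hac := twist_mem hJ (Subgroup.subset_closure hg) hca.symm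
      -- the 3-cycle moves `a` to `b` and fixes `c`
      have : twist a b g = ⁅twist a c g, permute (swap a e * swap a b)⁆ := by
        have h1 : (swap a e * swap a b) a = b := by
          rw [Perm.mul_apply, swap_apply_left, swap_apply_of_ne_of_ne hab.symm heb.symm]
        have h2 : (swap a e * swap a b) c = c := by
          rw [Perm.mul_apply, swap_apply_of_ne_of_ne hca hcb, swap_apply_of_ne_of_ne hca hec.symm]
        have h3 := permute_conj_twist (Ω := Ω) (swap a e * swap a b) a c g
        rw [h1, h2] at h3
        have h4 : ⁅twist a c g, permute (swap a e * swap a b)⁆ = twist a c g *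
            (permute (swap a e * swap a b) * twist a c g *
              (permute (swap a e * swap a b))⁻¹)⁻¹ := by
          rw [commutatorElement_def]; group
        rw [h4, h3, twist, twist, twist]
        group
      rw [SetLike.mem_coe, this]
      exact Subgroup.commutator_mem_commutator hac
        (permute_mem (swap_mul_swap_mem hea.symm hab))
  have h := Subgroup.map_subtype_commutator (alternatingTwist J S)
  rw [eq_top_iff]
  intro x _
  have hx : (x : Perm (J × Ω)) ∈ (commutator (alternatingTwist J S)).map
      (alternatingTwist J S).subtype := by
    rw [h]; exact hle x.2
  obtain ⟨y, hy, hyx⟩ := hx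
  rwa [← Subtype.ext hyx]

/-- `alternatingTwist J S` is normalized by the base group. -/
theorem single_conj_mem (hJ : 5 ≤ Fintype.card J) {h : Perm Ω} (hh : h ∈ Subgroup.closure S) (j : J)
    {d : Perm (J × Ω)} (hd : d ∈ alternatingTwist J S) :
    single j h * d * (single j h)⁻¹ ∈ alternatingTwist J S := by
  induction hd using Subgroup.closure_induction with
  | one => simp
  | mul x y _ _ hx hy => simpa using mul_mem hx hy
  | inv x _ hx => simpa [mul_assoc] using inv_mem hx
  | mem x hx =>
    rcases hx with ⟨σ, hσ, rfl⟩ | ⟨a, b, g, hg, hab, rfl⟩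
    · have : single j h * permute σ * (single j h)⁻¹ =
          single j h * (single (σ j) h)⁻¹ * permute σ := by
        rw [← map_inv, ← map_inv, mul_assoc, permute_mul_single, mul_assoc]
      rw [this]
      refine mul_mem ?_ (permute_mem hσ)
      by_cases hj : j = σ j
      · rw [← hj, mul_inv_cancel]; exact Subgroup.one_mem _
      · exact twist_mem hJ hh hj
    · -- conjugation by `single j h` agrees with conjugation by `twist j c h` for a new index `c`
      obtain ⟨c, hca, hcb, hcj⟩ := exists_ne_of_card (a := a) (b := b) (c := j) hJ
      have h1 : Commute (single c h) (twist a b g) :=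
        (single_commute hca _ _).mul_right (single_commute hcb _ _).inv_right
      have : single j h * twist a b g * (single j h)⁻¹ =
          twist j c h * twist a b g * (twist j c h)⁻¹ := by
        conv_rhs => rw [twist, mul_inv_rev, inv_inv]
        have h2 := h1.inv_left.eq
        calc _ = single j h * (twist a b g * (single c h)⁻¹) * (single c h * (single j h)⁻¹) := by
              group
          _ = _ := by rw [← h2]; group
      rw [this]
      have h2 := twist_mem hJ hh hcj.symm
      exact mul_mem (mul_mem h2 (Subgroup.subset_closure (Or.inr ⟨a, b, g, hg, hab, rfl⟩)))
        (inv_mem h2)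

theorem single_mem_of_mem_commutator (hJ : 5 ≤ Fintype.card J) (j : J) {h : Perm Ω}
    (hh : h ∈ ⁅Subgroup.closure S, Subgroup.closure S⁆) :
    single j h ∈ alternatingTwist J S := by
  suffices H : ⁅Subgroup.closure S, Subgroup.closure S⁆ ≤
      (alternatingTwist J S).comap (single j) from H hh
  rw [Subgroup.commutator_le]
  intro x hx y hy
  obtain ⟨b, hbj, -, -⟩ := exists_ne_of_card (a := j) (b := j) (c := j) hJ
  obtain ⟨c, hcj, hcb, -⟩ := exists_ne_of_card (a := j) (b := b) (c := b) hJ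
  have h1 := twist_mem hJ hx hbj.symm
  have h2 := twist_mem hJ hy hcj.symm
  have key : single j ⁅x, y⁆ = ⁅twist j b x, twist j c y⁆ := by
    refine Equiv.ext fun ⟨i, z⟩ => ?_
    have hdiag : ∀ (a d : J) (g : Perm Ω), twist a d g =
        diag (Pi.mulSingle a g * (Pi.mulSingle d g)⁻¹) := fun _ _ _ => by
      rw [map_mul, map_inv]; rfl
    rw [hdiag, hdiag, ← map_commutatorElement, diag_apply]
    change diag (Pi.mulSingle j ⁅x, y⁆) (i, z) = _
    rw [diag_apply]
    simp only [commutatorElement_def, Pi.mul_apply, Pi.inv_apply]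
    by_cases hij : i = j
    · subst hij
      simp [hbj.symm, hcj.symm]
    · by_cases hib : i = b
      · subst hib
        simp [hbj, hcb.symm]
      · simp [hij, hib]
  rw [Subgroup.mem_comap, key, commutatorElement_def]
  exact mul_mem (mul_mem (mul_mem h1 h2) (inv_mem h1)) (inv_mem h2)

theorem prod_single_mem (hJ : 5 ≤ Fintype.card J) {f : J → Perm Ω}
    (hf : ∀ j, f j ∈ Subgroup.closure S) (i : J) (l : List J) :
    (l.map fun j => single j (f j)).prod * (single i (l.map f).prod)⁻¹ ∈
      alternatingTwist J S := by
  induction l with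
  | nil => simp
  | cons j l ih =>
    have h1 := single_conj_mem hJ (hf j) j ih
    have h2 : single j (f j) * (single i (f j))⁻¹ ∈ alternatingTwist J S := by
      by_cases hij : j = i
      · rw [hij, mul_inv_cancel]; exact Subgroup.one_mem _
      · exact twist_mem hJ (hf j) hij
    have h3 := mul_mem h1 h2
    simp only [List.map_cons, List.prod_cons, map_mul, mul_inv_rev]
    convert h3 using 1
    group

theorem diag_mem (hJ : 5 ≤ Fintype.card J) {f : J → Perm Ω}
    (hf : ∀ j, f j ∈ Subgroup.closure S) {l : List J} (hl : l.Nodup) (hmem : ∀ j, j ∈ l)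
    (hprod : (l.map f).prod ∈ ⁅Subgroup.closure S, Subgroup.closure S⁆) :
    diag f ∈ alternatingTwist J S := by
  obtain ⟨i⟩ : Nonempty J := Fintype.card_pos_iff.1 (by omega)
  have h1 := mul_mem (prod_single_mem hJ hf i l) (single_mem_of_mem_commutator hJ i hprod)
  rw [inv_mul_cancel_right] at h1
  convert h1
  have : f = (l.map fun j => (Pi.mulSingle j (f j) : J → Perm Ω)).prod := by
    funext j
    rw [prod_mulSingle f l hl, if_pos (hmem j)]
  conv_lhs => rw [this, map_list_prod, List.map_map]
  rfl

/-- Elements of `alternatingTwist J S` permute the copies of `Ω` and act on each copy through an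
element of the closure of `S`. -/
theorem exists_apply_eq {d : Perm (J × Ω)} (hd : d ∈ alternatingTwist J S) (j : J) :
    ∃ j', ∃ g ∈ Subgroup.closure S, ∀ y, d (j, y) = (j', g y) := by
  have hsingle : ∀ (a : J), ∀ g ∈ Subgroup.closure S, ∀ j : J,
      ∃ h ∈ Subgroup.closure S, ∀ y, single a g (j, y) = (j, h y) := fun a g hg j => by
    by_cases h : j = a
    · subst h
      exact ⟨g, hg, single_apply_same j g⟩
    · exact ⟨1, Subgroup.one_mem _, single_apply_of_ne h g⟩
  induction hd using Subgroup.closure_induction'' generalizing j with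
  | one => exact ⟨j, 1, Subgroup.one_mem _, fun _ => rfl⟩
  | mul x y _ _ hx hy =>
    obtain ⟨j', g, hg, h1⟩ := hy j
    obtain ⟨j'', g', hg', h2⟩ := hx j'
    exact ⟨j'', g' * g, mul_mem hg' hg, fun z => by rw [Perm.mul_apply, h1, h2]; rfl⟩
  | mem x hx =>
    rcases hx with ⟨σ, hσ, rfl⟩ | ⟨a, b, g, hg, hab, rfl⟩
    · exact ⟨σ j, 1, Subgroup.one_mem _, fun _ => rfl⟩
    · obtain ⟨h, hh, h1⟩ := hsingle b g⁻¹ (inv_mem (Subgroup.subset_closure hg)) j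
      obtain ⟨h', hh', h2⟩ := hsingle a g (Subgroup.subset_closure hg) j
      refine ⟨j, h' * h, mul_mem hh' hh, fun y => ?_⟩
      rw [twist, Perm.mul_apply, ← map_inv, h1, h2]; rfl
  | inv_mem x hx =>
    rcases hx with ⟨σ, hσ, rfl⟩ | ⟨a, b, g, hg, hab, rfl⟩
    · exact ⟨σ⁻¹ j, 1, Subgroup.one_mem _, fun _ => rfl⟩
    · obtain ⟨h, hh, h1⟩ := hsingle a g⁻¹ (inv_mem (Subgroup.subset_closure hg)) j
      obtain ⟨h', hh', h2⟩ := hsingle b g (Subgroup.subset_closure hg) j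
      refine ⟨j, h' * h, mul_mem hh' hh, fun y => ?_⟩
      rw [twist, mul_inv_rev, inv_inv, Perm.mul_apply, ← map_inv, h1, h2]; rfl

/-- `alternatingTwist J S` is transitive on the union of the copies of an orbit of `closure S`. -/
theorem exists_apply_eq_of_orbit (hJ : 5 ≤ Fintype.card J) (i j : J) {g : Perm Ω}
    (hg : g ∈ Subgroup.closure S) (y : Ω) :
    ∃ d ∈ alternatingTwist J S, d (i, y) = (j, g y) := by
  obtain ⟨b, hbi, -, -⟩ := exists_ne_of_card (a := i) (b := i) (c := i) hJ
  have h1 : twist i b g (i, y) = (i, g y) := by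
    rw [twist, Perm.mul_apply, ← map_inv, single_apply_of_ne hbi.symm, single_apply_same]
  have hmem := twist_mem hJ hg hbi.symm
  by_cases hij : i = j
  · subst hij
    exact ⟨_, hmem, h1⟩
  · obtain ⟨c, hci, hcj, -⟩ := exists_ne_of_card (a := i) (b := j) (c := j) hJ
    refine ⟨permute (swap i c * swap i j) * twist i b g,
      mul_mem (permute_mem (swap_mul_swap_mem hci.symm hij)) hmem, ?_⟩
    rw [Perm.mul_apply, h1, permute_apply, Perm.mul_apply, swap_apply_left,
      swap_apply_of_ne_of_ne (Ne.symm hij) hcj.symm]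

/-- A 3-cycle of the copies of `Ω` fixes the copy `a` and moves `b` away from both. -/
theorem exists_fix_move (hJ : 5 ≤ Fintype.card J) {a b : J} (hab : a ≠ b) :
    ∃ d ∈ alternatingTwist J S, (∀ y, d (a, y) = (a, y)) ∧
      ∃ c, c ≠ a ∧ c ≠ b ∧ ∀ y, d (b, y) = (c, y) := by
  obtain ⟨c, hca, hcb, -⟩ := exists_ne_of_card (a := a) (b := b) (c := b) hJ
  obtain ⟨e, hea, heb, hec⟩ := exists_ne_of_card (a := a) (b := b) (c := c) hJ
  refine ⟨permute (swap b e * swap b c), permute_mem (swap_mul_swap_mem heb.symm hcb.symm),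
    fun y => ?_, c, hca, hcb, fun y => ?_⟩
  · rw [permute_apply, Perm.mul_apply, swap_apply_of_ne_of_ne hab hca.symm,
      swap_apply_of_ne_of_ne hab hea.symm]
  · rw [permute_apply, Perm.mul_apply, swap_apply_left, swap_apply_of_ne_of_ne hcb hec.symm]

end Wreath

/-! ### Spinal groups -/

section ListPerm

open Equiv

variable {L : Type*}

/-- The permutation of the words over `L` that applies a permutation of `L` to the first letter. -/
def headPerm : Perm L →* Perm (List L) where
  toFun π := ⟨List.modifyHead π, List.modifyHead π.symm, fun v => by cases v <;> simp,
    fun v => by cases v <;> simp⟩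
  map_one' := by ext1 v; cases v <;> rfl
  map_mul' π π' := by ext1 v; cases v <;> rfl

theorem headPerm_nil (π : Perm L) : headPerm π [] = [] := rfl

theorem headPerm_cons (π : Perm L) (x : L) (v : List L) : headPerm π (x :: v) = π x :: v := rfl

variable [DecidableEq L]

/-- The permutation of the words over `L` that applies a given permutation to what follows
the letter `x`, and fixes all words that do not start with `x`. -/
def below (x : L) : Perm (List L) →* Perm (List L) where
  toFun γ :=
    ⟨fun v => match v with
      | [] => []
      | y :: v => y :: if y = x then γ v else v,
      fun v => match v with
      | [] => []
      | y :: v => y :: if y = x then γ⁻¹ v else v,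
      fun v => by cases v <;> simp; split_ifs <;> simp,
      fun v => by cases v <;> simp; split_ifs <;> simp⟩
  map_one' := by ext1 v; cases v <;> simp
  map_mul' γ γ' := by ext1 v; cases v <;> simp; split_ifs <;> rfl

theorem below_cons (x y : L) (γ : Perm (List L)) (v : List L) :
    below x γ (y :: v) = y :: if y = x then γ v else v := rfl

theorem below_commute {x y : L} (h : x ≠ y) (γ γ' : Perm (List L)) :
    Commute (below x γ) (below y γ') := by
  refine Equiv.ext fun v => ?_
  cases v with
  | nil => rfl
  | cons z v =>
    simp only [Perm.mul_apply, below_cons]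
    by_cases hx : z = x
    · simp [hx, h]
    · simp [hx]

theorem headPerm_conj_below (π : Perm L) (x : L) (γ : Perm (List L)) :
    headPerm π * below x γ * (headPerm π)⁻¹ = below (π x) γ := by
  rw [mul_inv_eq_iff_eq_mul]
  refine Equiv.ext fun v => ?_
  cases v with
  | nil => rfl
  | cons z v => simp [Perm.mul_apply, below_cons, headPerm_cons]

/-- The permutation that applies a given permutation to what follows the prefix `v`. -/
def belowWord : List L → Perm (List L) →* Perm (List L)
  | [] => MonoidHom.id _
  | x :: v => (below x).comp (belowWord v)

theorem belowWord_append (v u : List L) (γ : Perm (List L)) :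
    belowWord v γ (v ++ u) = v ++ γ u := by
  induction v with
  | nil => rfl
  | cons x v ih =>
    change below x (belowWord v γ) (x :: (v ++ u)) = _
    rw [below_cons, if_pos rfl, ih, List.cons_append]

theorem belowWord_of_not_prefix {v w : List L} (h : ¬ v <+: w) (γ : Perm (List L)) :
    belowWord v γ w = w := by
  induction v generalizing w with
  | nil => exact absurd w.nil_prefix h
  | cons x v ih =>
    change below x (belowWord v γ) w = _
    cases w with
    | nil => rfl
    | cons y w =>
      rw [below_cons]
      split_ifs with hyx
      · subst hyx
        rw [ih fun hv => h ((List.prefix_cons_inj y).2 hv)]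
      · rfl

end ListPerm

theorem commutatorElement_mul_mul {G : Type*} [Group G] {a b c d : G}
    (hcb : Commute c b) (hbd : Commute b d) (had : Commute a d) :
    a * b * (c * d) * (a * b)⁻¹ * (c * d)⁻¹ = a * c * a⁻¹ * c⁻¹ := by
  have h1 : b * (c * d) = c * d * b := (hcb.symm.mul_right hbd).eq
  have h2 : d * a⁻¹ = a⁻¹ * d := had.symm.inv_right.eq
  calc a * b * (c * d) * (a * b)⁻¹ * (c * d)⁻¹
      = a * (b * (c * d)) * b⁻¹ * a⁻¹ * d⁻¹ * c⁻¹ := by group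
    _ = a * c * (d * a⁻¹) * d⁻¹ * c⁻¹ := by rw [h1]; group
    _ = _ := by rw [h2]; group

/-- The data that define a spinal group over a group `D`: a sequence of alphabets in `L`,
transitive actions of `D` on them (extended to `L` by the identity), and in each alphabet a letter
`spine n` of the spine and a letter `side n` next to it. -/
structure SpinalSystem (L : Type*) (D : Type*) [Group D] where
  alphabet : ℕ → Set L
  act : ℕ → D →* Equiv.Perm L
  spine : ℕ → L
  side : ℕ → L
  act_of_notMem : ∀ n d x, x ∉ alphabet n → act n d x = x
  spine_mem : ∀ n, spine n ∈ alphabet n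
  side_mem : ∀ n, side n ∈ alphabet n
  spine_ne_side : ∀ n, spine n ≠ side n
  exists_act_eq : ∀ n, ∀ x ∈ alphabet n, ∀ y ∈ alphabet n, ∃ d, act n d x = y
  exists_fix_spine : ∀ n, ∃ d, act n d (spine n) = spine n ∧ act n d (side n) ≠ spine n ∧
    act n d (side n) ≠ side n
  exists_fix_side : ∀ n, ∃ d, act n d (side n) = side n ∧ act n d (spine n) ≠ side n ∧
    act n d (spine n) ≠ spine n

namespace SpinalSystem

open Equiv
open scoped commutatorElement

variable {L : Type*} {D : Type*} [Group D] (P : SpinalSystem L D)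

/-- The words that are vertices of the tree with alphabets `alphabet n, alphabet (n + 1), …`. -/
def Valid : ℕ → List L → Prop
  | _, [] => True
  | n, x :: v => x ∈ P.alphabet n ∧ Valid (n + 1) v

theorem act_mem {n : ℕ} (d : D) {x : L} (hx : x ∈ P.alphabet n) : P.act n d x ∈ P.alphabet n := by
  by_contra h
  have h1 := P.act_of_notMem n d⁻¹ _ h
  rw [← Perm.mul_apply, ← map_mul, inv_mul_cancel, map_one, Perm.one_apply] at h1
  exact h (h1 ▸ hx)

theorem valid_append {n : ℕ} {v u : List L} :
    P.Valid n (v ++ u) ↔ P.Valid n v ∧ P.Valid (n + v.length) u := by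
  induction v generalizing n with
  | nil => simp [Valid]
  | cons x v ih =>
    simp only [List.cons_append, Valid, ih, List.length_cons, and_assoc]
    rw [Nat.add_right_comm, Nat.add_assoc]

/-- The word of length `k` along the spine. -/
def spineWord (n k : ℕ) : List L := (List.range' n k).map P.spine

theorem length_spineWord (n k : ℕ) : (P.spineWord n k).length = k := by simp [spineWord]

theorem valid_spineWord (n k : ℕ) : P.Valid n (P.spineWord n k) := by
  induction k generalizing n with
  | zero => trivial
  | succ k ih => exact ⟨P.spine_mem n, ih (n + 1)⟩

theorem finite_valid (hfin : ∀ n, (P.alphabet n).Finite) (n k : ℕ) :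
    {v | P.Valid n v ∧ v.length = k}.Finite := by
  induction k generalizing n with
  | zero =>
    refine (Set.finite_singleton []).subset ?_
    rintro v ⟨-, hv⟩
    exact List.length_eq_zero_iff.1 hv
  | succ k ih =>
    refine (((hfin n).prod (ih (n + 1))).image fun x => x.1 :: x.2).subset ?_
    rintro v ⟨hv, hk⟩
    cases v with
    | nil => simp at hk
    | cons x v => exact ⟨(x, v), ⟨hv.1, hv.2, by simpa using hk⟩, rfl⟩

/-- The action of `D` on the first letter. -/
def rooted (n : ℕ) : D →* Perm (List L) := headPerm.comp (P.act n)

theorem rooted_cons (n : ℕ) (d : D) (x : L) (v : List L) :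
    P.rooted n d (x :: v) = P.act n d x :: v := rfl

variable [DecidableEq L]

/-- The underlying function of `directed`. -/
def directedFun : ℕ → D → List L → List L
  | _, _, [] => []
  | n, d, x :: v => x :: if x = P.spine n then directedFun (n + 1) d v else
      if x = P.side n then P.rooted (n + 1) d v else v

theorem directedFun_one (n : ℕ) (v : List L) : P.directedFun n 1 v = v := by
  induction v generalizing n with
  | nil => rfl
  | cons x v ih => simp [directedFun, ih]

theorem directedFun_mul (n : ℕ) (d d' : D) (v : List L) :
    P.directedFun n (d * d') v = P.directedFun n d (P.directedFun n d' v) := by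
  induction v generalizing n with
  | nil => rfl
  | cons x v ih =>
    simp only [directedFun, ih, map_mul]
    split_ifs <;> rfl

/-- The directed action of `D`: the element `d` acts through `act (n + 1) d` on the letters below
`side n`, and so on along the spine. -/
def directed (n : ℕ) : D →* Perm (List L) where
  toFun d := ⟨P.directedFun n d, P.directedFun n d⁻¹,
    fun v => by rw [← directedFun_mul, inv_mul_cancel, directedFun_one],
    fun v => by rw [← directedFun_mul, mul_inv_cancel, directedFun_one]⟩
  map_one' := Equiv.ext fun v => P.directedFun_one n v
  map_mul' d d' := Equiv.ext fun v => P.directedFun_mul n d d' v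

theorem directed_cons (n : ℕ) (d : D) (x : L) (v : List L) : P.directed n d (x :: v) =
    x :: if x = P.spine n then P.directed (n + 1) d v else
      if x = P.side n then P.rooted (n + 1) d v else v := rfl

theorem directed_eq (n : ℕ) (d : D) : P.directed n d =
    below (P.spine n) (P.directed (n + 1) d) * below (P.side n) (P.rooted (n + 1) d) := by
  refine Equiv.ext fun v => ?_
  cases v with
  | nil => rfl
  | cons x v =>
    rw [Perm.mul_apply, below_cons, below_cons, directed_cons]
    by_cases h : x = P.spine n
    · rw [if_pos h, if_pos h, if_neg (h ▸ P.spine_ne_side n)]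
    · rw [if_neg h, if_neg h]

/-- The spinal group acting on the tree with alphabets `alphabet n, alphabet (n + 1), …`. -/
def group (n : ℕ) : Subgroup (Perm (List L)) :=
  Subgroup.closure (Set.range (P.rooted n) ∪ Set.range (P.directed n))

theorem rooted_mem (n : ℕ) (d : D) : P.rooted n d ∈ P.group n :=
  Subgroup.subset_closure (Or.inl ⟨d, rfl⟩)

theorem directed_mem (n : ℕ) (d : D) : P.directed n d ∈ P.group n :=
  Subgroup.subset_closure (Or.inr ⟨d, rfl⟩)

theorem group_induction {n : ℕ} {p : Perm (List L) → Prop} (h1 : p 1)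
    (hmul : ∀ a b, p a → p b → p (a * b)) (hr : ∀ d, p (P.rooted n d))
    (hd : ∀ d, p (P.directed n d)) {γ : Perm (List L)} (hγ : γ ∈ P.group n) : p γ := by
  refine Subgroup.closure_induction'' (p := fun γ _ => p γ) ?_ ?_ h1 (fun a b _ _ => hmul a b) hγ
  · rintro _ (⟨d, rfl⟩ | ⟨d, rfl⟩)
    · exact hr d
    · exact hd d
  · rintro _ (⟨d, rfl⟩ | ⟨d, rfl⟩)
    · rw [← map_inv]; exact hr _
    · rw [← map_inv]; exact hd _

theorem apply_nil {n : ℕ} {γ : Perm (List L)} (hγ : γ ∈ P.group n) : γ [] = [] := by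
  refine P.group_induction (p := fun γ => γ [] = []) rfl ?_ (fun _ => rfl) (fun _ => rfl) hγ
  intro a b ha hb
  rw [Perm.mul_apply, hb, ha]

theorem exists_section {n : ℕ} {γ : Perm (List L)} (hγ : γ ∈ P.group n) (x : L) :
    ∃ y, ∃ γ' ∈ P.group (n + 1), (∀ v, γ (x :: v) = y :: γ' v) ∧
      (x ∈ P.alphabet n → y ∈ P.alphabet n) ∧ (x ∉ P.alphabet n → y = x ∧ γ' = 1) := by
  refine P.group_induction (n := n) (p := fun γ => ∀ x, ∃ y, ∃ γ' ∈ P.group (n + 1),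
    (∀ v, γ (x :: v) = y :: γ' v) ∧ (x ∈ P.alphabet n → y ∈ P.alphabet n) ∧
      (x ∉ P.alphabet n → y = x ∧ γ' = 1)) ?_ ?_ ?_ ?_ hγ x
  · exact fun x => ⟨x, 1, Subgroup.one_mem _, fun _ => rfl, id, fun _ => ⟨rfl, rfl⟩⟩
  · intro a b ha hb x
    obtain ⟨y, γ', hγ', h1, h2, h3⟩ := hb x
    obtain ⟨z, γ'', hγ'', h1', h2', h3'⟩ := ha y
    refine ⟨z, γ'' * γ', mul_mem hγ'' hγ', fun v => by rw [Perm.mul_apply, h1, h1']; rfl,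
      fun hx => h2' (h2 hx), fun hx => ?_⟩
    obtain ⟨rfl, rfl⟩ := h3 hx
    obtain ⟨rfl, rfl⟩ := h3' hx
    exact ⟨rfl, one_mul 1⟩
  · exact fun d x => ⟨P.act n d x, 1, Subgroup.one_mem _, fun _ => rfl, P.act_mem d,
      fun hx => ⟨P.act_of_notMem n d x hx, rfl⟩⟩
  · intro d x
    by_cases h : x = P.spine n
    · exact ⟨x, P.directed (n + 1) d, P.directed_mem _ d,
        fun v => by rw [directed_cons, if_pos h], id,
        fun hx => absurd (h ▸ P.spine_mem n) hx⟩
    · by_cases h' : x = P.side n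
      · exact ⟨x, P.rooted (n + 1) d, P.rooted_mem _ d,
          fun v => by rw [directed_cons, if_neg h, if_pos h'], id,
          fun hx => absurd (h' ▸ P.side_mem n) hx⟩
      · exact ⟨x, 1, Subgroup.one_mem _,
          fun v => by rw [directed_cons, if_neg h, if_neg h']; rfl, id, fun _ => ⟨rfl, rfl⟩⟩

/-- Sections of elements of spinal groups lie in the spinal groups of the subtrees. -/
theorem exists_section_word {n : ℕ} {γ : Perm (List L)} (hγ : γ ∈ P.group n) (v : List L) :
    ∃ v', ∃ γ' ∈ P.group (n + v.length), (∀ u, γ (v ++ u) = v' ++ γ' u) ∧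
      v'.length = v.length ∧ (P.Valid n v → P.Valid n v') := by
  induction v generalizing n γ with
  | nil => exact ⟨[], γ, hγ, fun _ => rfl, rfl, id⟩
  | cons x v ih =>
    obtain ⟨y, γ', hγ', h1, h2, -⟩ := P.exists_section hγ x
    obtain ⟨v', γ'', hγ'', h1', h2', h3'⟩ := ih hγ'
    refine ⟨y :: v', γ'', ?_, fun u => by rw [List.cons_append, h1, h1', List.cons_append],
      by simp [h2'], fun hv => ⟨h2 hv.1, h3' hv.2⟩⟩
    rwa [List.length_cons, ← Nat.add_assoc, Nat.add_right_comm]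

theorem length_apply {n : ℕ} {γ : Perm (List L)} (hγ : γ ∈ P.group n) (v : List L) :
    (γ v).length = v.length := by
  obtain ⟨v', γ', hγ', h1, h2, -⟩ := P.exists_section_word hγ v
  have := h1 []
  rw [List.append_nil, P.apply_nil hγ', List.append_nil] at this
  rw [this, h2]

theorem valid_apply {n : ℕ} {γ : Perm (List L)} (hγ : γ ∈ P.group n) {v : List L}
    (hv : P.Valid n v) : P.Valid n (γ v) := by
  obtain ⟨v', γ', hγ', h1, -, h3⟩ := P.exists_section_word hγ v
  have := h1 []
  rw [List.append_nil, P.apply_nil hγ', List.append_nil] at this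
  rw [this]
  exact h3 hv

theorem exists_apply_append {n : ℕ} {γ : Perm (List L)} (hγ : γ ∈ P.group n) (v : List L) :
    ∃ γ' ∈ P.group (n + v.length), ∀ u, γ (v ++ u) = γ v ++ γ' u := by
  obtain ⟨v', γ', hγ', h1, -, -⟩ := P.exists_section_word hγ v
  have := h1 []
  rw [List.append_nil, P.apply_nil hγ', List.append_nil] at this
  exact ⟨γ', hγ', fun u => by rw [h1, this]⟩

theorem apply_prefix {n : ℕ} {γ : Perm (List L)} (hγ : γ ∈ P.group n) {v w : List L}
    (h : v <+: w) : γ v <+: γ w := by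
  obtain ⟨u, rfl⟩ := h
  obtain ⟨γ', -, h1⟩ := P.exists_apply_append hγ v
  exact ⟨γ' u, (h1 u).symm⟩

/-- An element that fixes all valid words of length at least `k` is trivial. -/
theorem eq_one_of_forall_valid {n : ℕ} {γ : Perm (List L)} (hγ : γ ∈ P.group n) (k : ℕ)
    (h : ∀ v, P.Valid n v → k ≤ v.length → γ v = v) : γ = 1 := by
  have h' : ∀ v, P.Valid n v → γ v = v := fun v hv => by
    obtain ⟨γ', hγ', h1⟩ := P.exists_apply_append hγ v
    have h2 := h (v ++ P.spineWord (n + v.length) k)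
      (P.valid_append.2 ⟨hv, P.valid_spineWord _ _⟩) (by simp [length_spineWord])
    rw [h1] at h2
    exact List.append_inj_left h2 (P.length_apply hγ v)
  clear h
  refine Equiv.ext fun v => ?_
  induction v generalizing n γ with
  | nil => exact P.apply_nil hγ
  | cons x v ih =>
    obtain ⟨y, γ', hγ', h1, -, h3⟩ := P.exists_section hγ x
    by_cases hx : x ∈ P.alphabet n
    · have h4 := h' [x] ⟨hx, trivial⟩
      rw [h1, P.apply_nil hγ', List.cons.injEq] at h4
      rw [h1, h4.1]
      refine congrArg (x :: ·) (ih hγ' fun u hu => ?_)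
      have h5 := h' (x :: u) ⟨hx, hu⟩
      rw [h1, List.cons.injEq] at h5
      exact h5.2
    · obtain ⟨rfl, rfl⟩ := h3 hx
      exact h1 v

theorem apply_eq_of_length_le {n N : ℕ} {γ : Perm (List L)} (hγ : γ ∈ P.group n)
    (h : ∀ v, P.Valid n v → v.length = N → γ v = v) {v : List L} (hv : P.Valid n v)
    (hN : v.length ≤ N) : γ v = v := by
  obtain ⟨γ', hγ', h1⟩ := P.exists_apply_append hγ v
  have h2 := h (v ++ P.spineWord (n + v.length) (N - v.length))
    (P.valid_append.2 ⟨hv, P.valid_spineWord _ _⟩) (by simp [length_spineWord]; omega)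
  rw [h1] at h2
  exact List.append_inj_left h2 (P.length_apply hγ v)

end SpinalSystem

/-! ### Spinal groups over perfect groups contain their copies on the subtrees -/

namespace SpinalSystem

open Equiv
open scoped commutatorElement

/-- The elements of the directed letters of a word. -/
def directedPart {D : Type*} (l : List (Bool × D)) : List D := (l.filter Prod.fst).map Prod.snd

theorem directedPart_sublist {D : Type*} (l : List (Bool × D)) :
    (directedPart l).Sublist (l.map Prod.snd) :=
  (List.filter_sublist).map _

theorem length_directedPart_lt {D : Type*} {l : List (Bool × D)} (h : ∃ d, (false, d) ∈ l) :
    (directedPart l).length < l.length := by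
  obtain ⟨d, hd⟩ := h
  rw [directedPart, List.length_map]
  exact List.length_filter_lt_length_iff_exists.2 ⟨_, hd, by simp⟩

variable {L : Type*} {D : Type*} [Group D] (P : SpinalSystem L D) [DecidableEq L]

theorem mem_of_forall_commutatorElement_mem (hD : commutator D = ⊤) {K : Subgroup D}
    (h : ∀ d d' : D, ⁅d, d'⁆ ∈ K) (d : D) : d ∈ K := by
  have h1 : commutator D ≤ K := by
    rw [commutator_def, Subgroup.commutator_le]
    exact fun d _ d' _ => h d d'
  exact h1 (hD ▸ Subgroup.mem_top d)

theorem rooted_conj_below (n : ℕ) (d : D) (x : L) (γ : Perm (List L)) :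
    P.rooted n d * below x γ * (P.rooted n d)⁻¹ = below (P.act n d x) γ :=
  headPerm_conj_below _ _ _

theorem rooted_conj_directed (n : ℕ) (a d : D) :
    P.rooted n a * P.directed n d * (P.rooted n a)⁻¹ =
      below (P.act n a (P.spine n)) (P.directed (n + 1) d) *
        below (P.act n a (P.side n)) (P.rooted (n + 1) d) := by
  rw [directed_eq, ← rooted_conj_below, ← rooted_conj_below]
  group

/-- Conjugate one of two directed elements by a rooted element that fixes the spine and moves
the side letter away: their commutator is supported below the spine. -/
theorem below_spine_directed_mem (hD : commutator D = ⊤) (n : ℕ) (d : D) :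
    below (P.spine n) (P.directed (n + 1) d) ∈ P.group n := by
  refine mem_of_forall_commutatorElement_mem (K := (P.group n).comap
    ((below (P.spine n)).comp (P.directed (n + 1)))) hD (fun d d' => ?_) d
  obtain ⟨a, h1, h2, h3⟩ := P.exists_fix_spine n
  have hc := P.rooted_conj_directed n a d'
  rw [h1] at hc
  have hmem : P.rooted n a * P.directed n d' * (P.rooted n a)⁻¹ ∈ P.group n :=
    mul_mem (mul_mem (P.rooted_mem n a) (P.directed_mem n d')) (inv_mem (P.rooted_mem n a))
  rw [hc] at hmem
  have hd := P.directed_mem n d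
  rw [directed_eq] at hd
  have key := mul_mem (mul_mem (mul_mem hd hmem) (inv_mem hd)) (inv_mem hmem)
  rw [commutatorElement_mul_mul (below_commute (P.spine_ne_side n) _ _)
    (below_commute h3.symm _ _) (below_commute h2.symm _ _)] at key
  rw [Subgroup.mem_comap, commutatorElement_def]
  simpa using key

/-- Conjugate one of two directed elements by a rooted element that fixes the side letter and
moves the spine away: their commutator is supported below the side letter. -/
theorem below_side_rooted_mem (hD : commutator D = ⊤) (n : ℕ) (d : D) :
    below (P.side n) (P.rooted (n + 1) d) ∈ P.group n := by
  refine mem_of_forall_commutatorElement_mem (K := (P.group n).comap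
    ((below (P.side n)).comp (P.rooted (n + 1)))) hD (fun d d' => ?_) d
  obtain ⟨a, h1, h2, h3⟩ := P.exists_fix_side n
  have hc := P.rooted_conj_directed n a d'
  rw [h1, (below_commute h2 _ _).eq] at hc
  have hmem : P.rooted n a * P.directed n d' * (P.rooted n a)⁻¹ ∈ P.group n :=
    mul_mem (mul_mem (P.rooted_mem n a) (P.directed_mem n d')) (inv_mem (P.rooted_mem n a))
  rw [hc] at hmem
  have hd := P.directed_mem n d
  rw [directed_eq, (below_commute (P.spine_ne_side n) _ _).eq] at hd
  have key := mul_mem (mul_mem (mul_mem hd hmem) (inv_mem hd)) (inv_mem hmem)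
  rw [commutatorElement_mul_mul (below_commute (P.spine_ne_side n).symm _ _)
    (below_commute h3.symm _ _) (below_commute h2.symm _ _)] at key
  rw [Subgroup.mem_comap, commutatorElement_def]
  simpa using key

theorem below_act_mem {n : ℕ} {x : L} {γ : Perm (List L)} (h : below x γ ∈ P.group n) (d : D) :
    below (P.act n d x) γ ∈ P.group n := by
  rw [← rooted_conj_below]
  exact mul_mem (mul_mem (P.rooted_mem n d) h) (inv_mem (P.rooted_mem n d))

theorem below_mem (hD : commutator D = ⊤) {n : ℕ} {x : L} (hx : x ∈ P.alphabet n)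
    {γ : Perm (List L)} (hγ : γ ∈ P.group (n + 1)) : below x γ ∈ P.group n := by
  obtain ⟨a, rfl⟩ := P.exists_act_eq n _ (P.spine_mem n) x hx
  refine P.below_act_mem ?_ a
  refine P.group_induction (p := fun γ => below (P.spine n) γ ∈ P.group n) ?_ ?_ ?_ ?_ hγ
  · simp
  · intro a b ha hb
    rw [map_mul]; exact mul_mem ha hb
  · intro d
    obtain ⟨b, hb⟩ := P.exists_act_eq n _ (P.side_mem n) _ (P.spine_mem n)
    rw [← hb]
    exact P.below_act_mem (P.below_side_rooted_mem hD n d) b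
  · exact P.below_spine_directed_mem hD n

theorem belowWord_mem (hD : commutator D = ⊤) {n : ℕ} {v : List L} (hv : P.Valid n v)
    {γ : Perm (List L)} (hγ : γ ∈ P.group (n + v.length)) : belowWord v γ ∈ P.group n := by
  induction v generalizing n with
  | nil => exact hγ
  | cons x v ih =>
    refine P.below_mem hD hv.1 (ih hv.2 ?_)
    rwa [List.length_cons, ← Nat.add_assoc, Nat.add_right_comm] at hγ

theorem exists_apply_eq (hD : commutator D = ⊤) {n : ℕ} {v w : List L} (hv : P.Valid n v)
    (hw : P.Valid n w) (h : v.length = w.length) : ∃ γ ∈ P.group n, γ v = w := by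
  induction v generalizing n w with
  | nil =>
    rw [List.length_nil, eq_comm, List.length_eq_zero_iff] at h
    exact ⟨1, Subgroup.one_mem _, h.symm⟩
  | cons x v ih =>
    cases w with
    | nil => simp at h
    | cons y w =>
      obtain ⟨γ, hγ, h1⟩ := ih hv.2 hw.2 (by simpa using h)
      obtain ⟨d, hd⟩ := P.exists_act_eq n x hv.1 y hw.1
      refine ⟨below y γ * P.rooted n d, mul_mem (P.below_mem hD hw.1 hγ) (P.rooted_mem n d), ?_⟩
      rw [Perm.mul_apply, rooted_cons, hd, below_cons, if_pos rfl, h1]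

/-- An element that fixes all words of length `k` is the product of its sections, which act
on disjoint subtrees. -/
theorem mem_closure_belowWord (hD : commutator D = ⊤) (hfin : ∀ n, (P.alphabet n).Finite)
    {n k : ℕ} {γ : Perm (List L)} (hγ : γ ∈ P.group n)
    (hfix : ∀ v, P.Valid n v → v.length = k → γ v = v) :
    γ ∈ Subgroup.closure {x | ∃ v, P.Valid n v ∧ v.length = k ∧
      ∃ δ, belowWord v δ ∈ P.group n ∧ belowWord v δ = x} := by
  set K := Subgroup.closure {x | ∃ v, P.Valid n v ∧ v.length = k ∧
      ∃ δ, belowWord v δ ∈ P.group n ∧ belowWord v δ = x} with hK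
  have hKle : K ≤ P.group n := by
    rw [hK, Subgroup.closure_le]
    rintro _ ⟨v, -, -, δ, h, rfl⟩
    exact h
  have step : ∀ F : Finset (List L), (∀ v ∈ F, P.Valid n v ∧ v.length = k) → ∃ η ∈ K,
      (∀ v ∈ F, ∀ u, η (v ++ u) = γ (v ++ u)) ∧
      ∀ v, v ∉ F → v.length = k → ∀ u, η (v ++ u) = v ++ u := by
    intro F
    induction F using Finset.induction_on with
    | empty =>
      exact fun _ => ⟨1, Subgroup.one_mem _, fun v hv => absurd hv (Finset.notMem_empty v),
        fun _ _ _ _ => rfl⟩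
    | insert v F hvF ih =>
      intro hF
      obtain ⟨η, hη, h1, h2⟩ := ih fun w hw => hF w (Finset.mem_insert_of_mem hw)
      obtain ⟨hv, hvk⟩ := hF v (Finset.mem_insert_self v F)
      obtain ⟨γ', hγ', h3⟩ := P.exists_apply_append hγ v
      rw [hfix v hv hvk] at h3
      -- a word of length `k` other than `v` is not a prefix of a word below `v`
      have hne : ∀ w, w ≠ v → w.length = k → ∀ u, belowWord v γ' (w ++ u) = w ++ u :=
        fun w hwv hwk u => belowWord_of_not_prefix (fun hp =>
          hwv ((List.append_inj hp.choose_spec (hvk.trans hwk.symm)).1.symm)) _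
      refine ⟨belowWord v γ' * η, mul_mem (Subgroup.subset_closure
        ⟨v, hv, hvk, γ', P.belowWord_mem hD hv hγ', rfl⟩) hη,
        fun w hw u => ?_, fun w hw hwk u => ?_⟩
      · rcases Finset.mem_insert.1 hw with rfl | hwF
        · rw [Perm.mul_apply, h2 w hvF hvk, belowWord_append, h3]
        · obtain ⟨hwv, hwk⟩ := hF w hw
          have hwne : w ≠ v := fun h => hvF (h ▸ hwF)
          obtain ⟨γ'', -, h4⟩ := P.exists_apply_append hγ w
          rw [Perm.mul_apply, h1 w hwF, h4, hfix w hwv hwk, hne w hwne hwk]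
      · have hwne : w ≠ v := fun h => hw (h ▸ Finset.mem_insert_self v F)
        rw [Perm.mul_apply, h2 w (fun h => hw (Finset.mem_insert_of_mem h)) hwk, hne w hwne hwk]
  obtain ⟨η, hη, h1, -⟩ := step (P.finite_valid hfin n k).toFinset fun v hv => by simpa using hv
  suffices γ = η from this ▸ hη
  rw [← inv_mul_eq_one]
  refine (P.eq_one_of_forall_valid (mul_mem (inv_mem hγ) (hKle hη)) k fun v hv hk => ?_)
  rw [Perm.mul_apply, Perm.inv_eq_iff_eq]
  have h2 := h1 (v.take k) (by
    have := P.valid_append.1 ((List.take_append_drop k v).symm ▸ hv)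
    simpa [hk] using this.1) (v.drop k)
  rwa [List.take_append_drop] at h2

/-! ### The word problem of a spinal group -/

/-- The element of the spinal group given by a letter: `(true, d)` is the directed and `(false, d)`
the rooted element of `d`. -/
def letter (n : ℕ) (c : Bool × D) : Perm (List L) :=
  if c.1 then P.directed n c.2 else P.rooted n c.2

/-- The value of a word in rooted and directed elements. -/
def eval (n : ℕ) (l : List (Bool × D)) : Perm (List L) := (l.map (P.letter n)).prod

theorem eval_nil (n : ℕ) : P.eval n [] = 1 := rfl

theorem eval_cons (n : ℕ) (c : Bool × D) (l : List (Bool × D)) :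
    P.eval n (c :: l) = P.letter n c * P.eval n l := rfl

theorem eval_mem (n : ℕ) (l : List (Bool × D)) : P.eval n l ∈ P.group n := by
  refine Subgroup.list_prod_mem _ fun x hx => ?_
  obtain ⟨⟨b, d⟩, -, rfl⟩ := List.mem_map.1 hx
  cases b
  · exact P.rooted_mem n d
  · exact P.directed_mem n d

theorem eval_of_forall_directed (n : ℕ) {l : List (Bool × D)} (h : ∀ d, (false, d) ∉ l) :
    P.eval n l = P.directed n (l.map Prod.snd).prod := by
  induction l with
  | nil => simp [eval_nil]
  | cons c l ih =>
    obtain ⟨b, d⟩ := c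
    cases b
    · exact absurd List.mem_cons_self (h d)
    · rw [eval_cons, ih fun d hd => h d (List.mem_cons_of_mem _ hd), List.map_cons, List.prod_cons,
        map_mul]
      rfl

/-- Each directed letter of a word contributes at most one letter to the section at a letter `x`,
and rooted letters contribute nothing. -/
theorem exists_section_eval (n : ℕ) (l : List (Bool × D)) (x : L) : ∃ y, ∃ l' : List (Bool × D),
    (∀ v, P.eval n l (x :: v) = y :: P.eval (n + 1) l' v) ∧
      (l'.map Prod.snd).Sublist (directedPart l) := by
  induction l with
  | nil => exact ⟨x, [], fun _ => rfl, List.Sublist.slnil⟩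
  | cons c l ih =>
    obtain ⟨y, l', h1, h2⟩ := ih
    obtain ⟨b, d⟩ := c
    cases b
    · exact ⟨P.act n d y, l', fun v => by rw [eval_cons, Perm.mul_apply, h1]; rfl, h2⟩
    · have hdir : directedPart ((true, d) :: l) = d :: directedPart l := rfl
      rw [hdir]
      have h3 : ∀ v, P.eval n ((true, d) :: l) (x :: v) =
          P.directed n d (y :: P.eval (n + 1) l' v) := fun v => by
        rw [eval_cons, Perm.mul_apply, h1]; rfl
      by_cases hs : y = P.spine n
      · refine ⟨y, (true, d) :: l', fun v => ?_, h2.cons_cons d⟩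
        rw [h3, directed_cons, if_pos hs]; rfl
      · by_cases hs' : y = P.side n
        · refine ⟨y, (false, d) :: l', fun v => ?_, h2.cons_cons d⟩
          rw [h3, directed_cons, if_neg hs, if_pos hs']; rfl
        · refine ⟨y, l', fun v => ?_, h2.cons d⟩
          rw [h3, directed_cons, if_neg hs, if_neg hs']

/-- The directed element of `d` on the tree of index `n` shows the action of `d` of any
index `j > n`. -/
theorem act_eq_one_of_directed {n j k : ℕ} (hj : n < j) (hk : j < n + k) {d : D}
    (h : ∀ v, P.Valid n v → v.length ≤ k → P.directed n d v = v) : P.act j d = 1 := by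
  induction k generalizing n with
  | zero => omega
  | succ k ih =>
    rcases (Nat.succ_le_of_lt hj).eq_or_lt with rfl | hj'
    · refine Equiv.ext fun x => ?_
      by_cases hx : x ∈ P.alphabet (n + 1)
      · have h1 := h [P.side n, x] ⟨P.side_mem n, hx, trivial⟩ (by simp; omega)
        rw [directed_cons, if_neg (P.spine_ne_side n).symm, if_pos rfl, rooted_cons] at h1
        simpa using h1
      · exact P.act_of_notMem _ _ _ hx
    · refine ih hj' (by omega) fun v hv hvk => ?_
      have h1 := h (P.spine n :: v) ⟨P.spine_mem n, hv⟩ (by simpa using hvk)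
      rw [directed_cons, if_pos rfl] at h1
      simpa using h1

/-- A word with at most `k` directed letters is trivial if it acts trivially up to level `M + 1`,
provided that each nontrivial product of a sublist of its directed letters is detected by the
action of some index between `n + k + 1` and `M`: the sections of the word either have fewer
directed letters or are directed elements of such products. -/
theorem eval_eq_one_of_level {k n M : ℕ} {l : List (Bool × D)} (hk : (directedPart l).length ≤ k)
    (hM : n + k ≤ M)
    (hdet : ∀ u : List D, u.Sublist (directedPart l) → u.prod ≠ 1 →
      ∃ j, n + k + 1 ≤ j ∧ j ≤ M ∧ P.act j u.prod ≠ 1)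
    (htriv : ∀ v, P.Valid n v → v.length ≤ M + 1 - n → P.eval n l v = v) : P.eval n l = 1 := by
  induction k generalizing n l with
  | zero =>
    have hl : directedPart l = [] := List.length_eq_zero_iff.1 (Nat.le_zero.1 hk)
    refine P.eq_one_of_forall_valid (P.eval_mem n l) 0 fun v hv _ => ?_
    cases v with
    | nil => exact P.apply_nil (P.eval_mem n l)
    | cons x v =>
      obtain ⟨y, l', h1, h2⟩ := P.exists_section_eval n l x
      rw [hl, List.sublist_nil, List.map_eq_nil_iff] at h2
      subst h2
      have h3 := htriv [x] ⟨hv.1, trivial⟩ (by simp; omega)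
      rw [h1, eval_nil] at h3
      rw [h1, eval_nil]
      simpa using h3
  | succ k ih =>
    refine P.eq_one_of_forall_valid (P.eval_mem n l) 0 fun v hv _ => ?_
    cases v with
    | nil => exact P.apply_nil (P.eval_mem n l)
    | cons x v =>
      obtain ⟨y, l', h1, h2⟩ := P.exists_section_eval n l x
      have hxy : y = x := by
        have h3 := htriv [x] ⟨hv.1, trivial⟩ (by simp; omega)
        rw [h1] at h3
        exact (List.cons.inj h3).1
      subst hxy
      have htriv' : ∀ v, P.Valid (n + 1) v → v.length ≤ M + 1 - (n + 1) →
          P.eval (n + 1) l' v = v := fun v' hv' hl' => by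
        have h3 := htriv (y :: v') ⟨hv.1, hv'⟩ (by simp; omega)
        rw [h1] at h3
        exact (List.cons.inj h3).2
      suffices P.eval (n + 1) l' = 1 by rw [h1, this]; rfl
      by_cases hl' : ∃ d, (false, d) ∈ l'
      · have hlt := length_directedPart_lt hl'
        have hle := h2.length_le
        rw [List.length_map] at hle
        refine ih (by omega) (by omega) (fun u hu hne => ?_) htriv'
        obtain ⟨j, h3, h4, h5⟩ := hdet u ((hu.trans (directedPart_sublist l')).trans h2) hne
        exact ⟨j, by omega, h4, h5⟩
      · push Not at hl'
        rw [P.eval_of_forall_directed _ hl'] at htriv' ⊢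
        by_contra hne
        have hne' : (l'.map Prod.snd).prod ≠ 1 := fun h => hne (by rw [h, map_one])
        obtain ⟨j, h3, h4, h5⟩ := hdet _ h2 hne'
        exact h5 (P.act_eq_one_of_directed (by omega) (by omega) htriv')

/-- If every nontrivial element of `D` is detected by the action of infinitely many indices,
then `D` embeds into the spinal group through the directed elements. -/
theorem directed_injective (hdet : ∀ d : D, d ≠ 1 → ∀ N, ∃ j, N ≤ j ∧ P.act j d ≠ 1) (n : ℕ) :
    Function.Injective (P.directed n) := by
  rw [injective_iff_map_eq_one]
  intro d hd
  by_contra hne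
  obtain ⟨j, hj, h⟩ := hdet d hne (n + 1)
  exact h (P.act_eq_one_of_directed (k := j + 1 - n) hj (by omega) fun v _ _ => by rw [hd]; rfl)

end SpinalSystem

/-! ### The action of a spinal group on a rooted tree -/

namespace SpinalSystem

open Equiv

variable {L : Type} {D : Type*} [Group D] (P : SpinalSystem L D)

theorem valid_iff_getElem {n : ℕ} {v : List L} :
    P.Valid n v ↔ ∀ (i : ℕ) (h : i < v.length), v[i] ∈ P.alphabet (n + i) := by
  induction v generalizing n with
  | nil => simp [Valid]
  | cons x v ih =>
    rw [Valid, ih]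
    constructor
    · rintro ⟨hx, hv⟩ i hi
      cases i with
      | zero => exact hx
      | succ i =>
        have := hv i (by simpa using hi)
        rwa [Nat.add_right_comm, Nat.add_assoc] at this
    · intro h
      refine ⟨h 0 (by simp), fun i hi => ?_⟩
      have := h (i + 1) (by simpa using hi)
      rwa [← Nat.add_assoc, Nat.add_right_comm] at this

/-- The alphabets of the tree on which the spinal group acts. -/
abbrev Letters (n : ℕ) : Type := P.alphabet n

/-- A vertex of the tree as a word over `L`. -/
def toWord (v : TreeVertex P.Letters) : List L := List.ofFn fun i => (v.2 i : L)

theorem length_toWord (v : TreeVertex P.Letters) : (P.toWord v).length = v.level := by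
  simp [toWord, TreeVertex.level]

theorem valid_toWord (v : TreeVertex P.Letters) : P.Valid 0 (P.toWord v) := by
  rw [valid_iff_getElem]
  intro i hi
  simp only [toWord, List.getElem_ofFn, Nat.zero_add]
  exact (v.2 ⟨i, by simpa [toWord] using hi⟩).2

/-- A valid word as a vertex of the tree. -/
def ofWord (v : List L) (hv : P.Valid 0 v) : TreeVertex P.Letters :=
  ⟨v.length, fun i => ⟨v[i], by simpa using P.valid_iff_getElem.1 hv i i.2⟩⟩

theorem toWord_ofWord (v : List L) (hv : P.Valid 0 v) : P.toWord (P.ofWord v hv) = v := by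
  simp [toWord, ofWord]

theorem toWord_injective : Function.Injective P.toWord := by
  rintro ⟨m, f⟩ ⟨n, g⟩ h
  have h1 := List.ofFn_inj'.1 h
  obtain rfl : m = n := congrArg Sigma.fst h1
  congr 1
  funext i
  exact Subtype.ext (congrFun (eq_of_heq (Sigma.mk.inj h1).2) i)

theorem isPrefix_iff {v w : TreeVertex P.Letters} :
    TreeVertex.IsPrefix v w ↔ P.toWord v <+: P.toWord w := by
  rw [List.prefix_iff_getElem]
  constructor
  · rintro ⟨h, h1⟩
    refine ⟨by simpa [length_toWord, TreeVertex.level] using h, fun i hi => ?_⟩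
    have hi' : i < v.1 := by simpa [length_toWord, TreeVertex.level] using hi
    simpa [toWord] using congrArg Subtype.val (h1 ⟨i, hi'⟩)
  · rintro ⟨h, h1⟩
    refine ⟨by simpa [length_toWord, TreeVertex.level] using h, fun i => Subtype.ext ?_⟩
    have h2 := h1 i (by simp [length_toWord, TreeVertex.level])
    simp only [toWord, List.getElem_ofFn] at h2
    exact h2

theorem isChild_iff {v w : TreeVertex P.Letters} : TreeVertex.IsChild v w ↔
    (P.toWord w).length = (P.toWord v).length + 1 ∧ P.toWord v <+: P.toWord w := by
  rw [TreeVertex.IsChild, isPrefix_iff, length_toWord, length_toWord]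

variable [DecidableEq L]

/-- The action of an element of the spinal group on the vertices. -/
def vertexMap (γ : P.group 0) (v : TreeVertex P.Letters) : TreeVertex P.Letters :=
  P.ofWord (γ.1 (P.toWord v)) (P.valid_apply γ.2 (P.valid_toWord v))

theorem toWord_vertexMap (γ : P.group 0) (v : TreeVertex P.Letters) :
    P.toWord (P.vertexMap γ v) = γ.1 (P.toWord v) := P.toWord_ofWord _ _

theorem vertexMap_one (v : TreeVertex P.Letters) : P.vertexMap 1 v = v :=
  P.toWord_injective (P.toWord_vertexMap _ _)

theorem vertexMap_mul (γ γ' : P.group 0) (v : TreeVertex P.Letters) :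
    P.vertexMap (γ * γ') v = P.vertexMap γ (P.vertexMap γ' v) := by
  apply P.toWord_injective
  rw [toWord_vertexMap, toWord_vertexMap, toWord_vertexMap]
  rfl

theorem isChild_vertexMap (γ : P.group 0) {v w : TreeVertex P.Letters}
    (h : TreeVertex.IsChild v w) :
    TreeVertex.IsChild (P.vertexMap γ v) (P.vertexMap γ w) := by
  rw [isChild_iff] at h ⊢
  rw [toWord_vertexMap, toWord_vertexMap, P.length_apply γ.2, P.length_apply γ.2]
  exact ⟨h.1, P.apply_prefix γ.2 h.2⟩

/-- An element of the spinal group as a permutation of the vertices. -/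
def vertexPerm (γ : P.group 0) : Perm (TreeVertex P.Letters) where
  toFun := P.vertexMap γ
  invFun := P.vertexMap γ⁻¹
  left_inv v := by rw [← vertexMap_mul, inv_mul_cancel, vertexMap_one]
  right_inv v := by rw [← vertexMap_mul, mul_inv_cancel, vertexMap_one]

theorem adj_vertexMap (γ : P.group 0) {v w : TreeVertex P.Letters}
    (h : (rootedTree P.Letters).Adj v w) :
    (rootedTree P.Letters).Adj (P.vertexMap γ v) (P.vertexMap γ w) := by
  rw [rootedTree, SimpleGraph.fromRel_adj] at h ⊢
  exact ⟨(P.vertexPerm γ).injective.ne h.1,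
    h.2.imp (P.isChild_vertexMap γ) (P.isChild_vertexMap γ)⟩

/-- The action of the spinal group by automorphisms of the tree. -/
def treeAut : P.group 0 →* rootedAut P.Letters where
  toFun γ := ⟨⟨P.vertexPerm γ, by
      intro v w
      refine ⟨fun h => ?_, P.adj_vertexMap γ⟩
      have h1 := P.adj_vertexMap γ⁻¹ h
      change (rootedTree P.Letters).Adj (P.vertexMap γ⁻¹ (P.vertexMap γ v))
        (P.vertexMap γ⁻¹ (P.vertexMap γ w)) at h1
      rwa [← vertexMap_mul, ← vertexMap_mul, inv_mul_cancel, vertexMap_one, vertexMap_one] at h1⟩,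
    P.toWord_injective ((P.toWord_vertexMap γ _).trans (P.apply_nil γ.2))⟩
  map_one' := Subtype.ext (RelIso.ext fun v => P.vertexMap_one v)
  map_mul' γ γ' := Subtype.ext (RelIso.ext fun v => P.vertexMap_mul γ γ' v)

theorem toWord_treeAut (γ : P.group 0) (v : TreeVertex P.Letters) :
    P.toWord ((P.treeAut γ).1 v) = γ.1 (P.toWord v) := P.toWord_vertexMap γ v

theorem treeAut_injective : Function.Injective P.treeAut := by
  rw [injective_iff_map_eq_one]
  intro γ hγ
  refine Subtype.ext (P.eq_one_of_forall_valid γ.2 0 fun v hv _ => ?_)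
  have h1 := P.toWord_treeAut γ (P.ofWord v hv)
  rw [hγ, toWord_ofWord] at h1
  exact h1.symm.trans (P.toWord_ofWord v hv)

theorem isSphericallyTransitive_range (hD : commutator D = ⊤) :
    IsSphericallyTransitive P.treeAut.range := by
  intro v w h
  obtain ⟨γ, hγ, h1⟩ := P.exists_apply_eq hD (P.valid_toWord v) (P.valid_toWord w)
    (by rw [length_toWord, length_toWord, h])
  exact ⟨P.treeAut ⟨γ, hγ⟩, ⟨_, rfl⟩, P.toWord_injective (by rw [toWord_treeAut, h1])⟩

theorem treeAut_mem_rigidLevelStabilizer (hD : commutator D = ⊤)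
    (hfin : ∀ n, (P.alphabet n).Finite) {k : ℕ} (γ : P.group 0)
    (hfix : ∀ v, P.Valid 0 v → v.length = k → γ.1 v = v) :
    P.treeAut γ ∈ rigidLevelStabilizer P.treeAut.range k := by
  have key : ∃ h : γ.1 ∈ P.group 0,
      P.treeAut ⟨γ.1, h⟩ ∈ rigidLevelStabilizer P.treeAut.range k := by
    refine Subgroup.closure_induction (p := fun x _ => ∃ h : x ∈ P.group 0,
      P.treeAut ⟨x, h⟩ ∈ rigidLevelStabilizer P.treeAut.range k) ?_ ?_ ?_ ?_
      (P.mem_closure_belowWord hD hfin γ.2 hfix)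
    · rintro _ ⟨v, hv, hvk, δ, hδ, rfl⟩
      refine ⟨hδ, ?_⟩
      have hle : rigidStabilizer P.treeAut.range (P.ofWord v hv) ≤
          rigidLevelStabilizer P.treeAut.range k :=
        le_iSup₂_of_le (f := fun (v : TreeVertex P.Letters) (_ : v.level = k) =>
          rigidStabilizer P.treeAut.range v) (P.ofWord v hv) hvk le_rfl
      refine hle ⟨⟨_, rfl⟩, P.toWord_injective ?_, fun w hw => P.toWord_injective ?_⟩
      · rw [toWord_treeAut, toWord_ofWord]
        have h1 := belowWord_append v [] δ
        have h2 := P.length_apply hδ (v ++ [])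
        rw [h1, List.length_append, List.length_append, Nat.add_left_cancel_iff, List.length_nil,
          List.length_eq_zero_iff] at h2
        rw [h2, List.append_nil] at h1
        exact h1
      · rw [isPrefix_iff, toWord_ofWord] at hw
        rw [toWord_treeAut]
        exact belowWord_of_not_prefix hw δ
    · exact ⟨Subgroup.one_mem _, by
        rw [show (⟨1, Subgroup.one_mem _⟩ : P.group 0) = 1 from rfl, map_one]
        exact Subgroup.one_mem _⟩
    · rintro x y _ _ ⟨hx, hx'⟩ ⟨hy, hy'⟩
      refine ⟨mul_mem hx hy, ?_⟩
      rw [show (⟨x * y, mul_mem hx hy⟩ : P.group 0) = ⟨x, hx⟩ * ⟨y, hy⟩ from rfl, map_mul]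
      exact mul_mem hx' hy'
    · rintro x _ ⟨hx, hx'⟩
      refine ⟨inv_mem hx, ?_⟩
      rw [show (⟨x⁻¹, inv_mem hx⟩ : P.group 0) = ⟨x, hx⟩⁻¹ from rfl, map_inv]
      exact inv_mem hx'
  exact key.2

/-- The action of the spinal group on a level of the tree. -/
def levelAction (k : ℕ) : P.group 0 →* Perm {v // P.Valid 0 v ∧ v.length = k} where
  toFun γ :=
    ⟨fun v => ⟨γ.1 v, P.valid_apply γ.2 v.2.1, (P.length_apply γ.2 _).trans v.2.2⟩,
      fun v => ⟨(γ⁻¹).1 v, P.valid_apply (γ⁻¹).2 v.2.1, (P.length_apply (γ⁻¹).2 _).trans v.2.2⟩,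
      fun v => Subtype.ext (by simp), fun v => Subtype.ext (by simp)⟩
  map_one' := rfl
  map_mul' _ _ := rfl

theorem isBranchSubgroup_range (hD : commutator D = ⊤) (hfin : ∀ n, (P.alphabet n).Finite) :
    IsBranchSubgroup P.treeAut.range := by
  refine ⟨P.isSphericallyTransitive_range hD, fun k => ⟨?_⟩⟩
  have : Finite {v // P.Valid 0 v ∧ v.length = k} := (P.finite_valid hfin 0 k).to_subtype
  rw [← Subgroup.index_comap_of_surjective _ P.treeAut.rangeRestrict_surjective]
  have hle : (P.levelAction k).ker ≤
      ((rigidLevelStabilizer P.treeAut.range k).subgroupOf P.treeAut.range).comap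
        P.treeAut.rangeRestrict := by
    intro γ hγ
    refine P.treeAut_mem_rigidLevelStabilizer hD hfin γ fun v hv hk => ?_
    exact congrArg (fun π : Perm {v // P.Valid 0 v ∧ v.length = k} => (π ⟨v, hv, hk⟩).1) hγ
  exact (Subgroup.finiteIndex_of_le hle).index_ne_zero

/-- A spinal group over a perfect group with finite alphabets is a branch group. -/
theorem isBranchGroup_of_mulEquiv (hD : commutator D = ⊤) (hfin : ∀ n, (P.alphabet n).Finite)
    {Γ : Type u} [Group Γ] (e : Γ ≃* P.group 0) : IsBranchGroup Γ := by
  refine ⟨P.Letters, fun n => (hfin n).to_subtype, fun n => ?_, P.treeAut.range,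
    P.isBranchSubgroup_range hD hfin, ⟨e.trans (MonoidHom.ofInjective P.treeAut_injective)⟩⟩
  have : Finite (P.Letters n) := (hfin n).to_subtype
  have : Nontrivial (P.Letters n) := ⟨⟨_, P.spine_mem n⟩, ⟨_, P.side_mem n⟩,
    fun h => P.spine_ne_side n (congrArg Subtype.val h)⟩
  exact Finite.one_lt_card

end SpinalSystem

/-! ### The spinal group of a computable action -/

section Cutoff

open Equiv

variable {L : Type*}

open Classical in
/-- The action of a permutation group on an invariant set, extended by the identity. -/
noncomputable def cutoff (D : Subgroup (Perm L)) (A : Set L) (hA : ∀ d ∈ D, ∀ x ∈ A, d x ∈ A) :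
    D →* Perm L where
  toFun d :=
    ⟨fun x => if x ∈ A then d.1 x else x, fun x => if x ∈ A then (d⁻¹).1 x else x, fun x => by
      by_cases hx : x ∈ A
      · simp [hx, hA d.1 d.2 x hx]
      · simp [hx], fun x => by
      by_cases hx : x ∈ A
      · have := hA _ (d⁻¹).2 x hx
        simp only [hx, if_true, this]
        simp
      · simp [hx]⟩
  map_one' := by ext1 x; simp
  map_mul' d d' := by
    ext1 x
    by_cases hx : x ∈ A
    · simp [hx, hA d'.1 d'.2 x hx]
    · simp [hx]

theorem cutoff_of_mem {D : Subgroup (Perm L)} {A : Set L} (hA : ∀ d ∈ D, ∀ x ∈ A, d x ∈ A)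
    (d : D) {x : L} (hx : x ∈ A) : cutoff D A hA d x = d.1 x := if_pos hx

theorem cutoff_of_notMem {D : Subgroup (Perm L)} {A : Set L} (hA : ∀ d ∈ D, ∀ x ∈ A, d x ∈ A)
    (d : D) {x : L} (hx : x ∉ A) : cutoff D A hA d x = x := if_neg hx

end Cutoff

namespace SpinalSystem

open Equiv Wreath

variable {Ω : Type} [Denumerable Ω]

/-- A sequence that takes each value infinitely often. -/
def basePoint (Ω : Type) [Denumerable Ω] (n : ℕ) : Ω := Denumerable.ofNat Ω n.unpair.1

theorem basePoint_pair (y : Ω) (N : ℕ) : basePoint Ω (Nat.pair (Encodable.encode y) N) = y := by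
  simp [basePoint]

theorem computable_basePoint : Computable (basePoint Ω) :=
  (Computable.ofNat Ω).comp (Computable.fst.comp Computable.unpair)

variable {G : Type u} [Group G] {m : ℕ} {S : Set (Perm Ω)} (θ : G →* Perm Ω)

/-- The copies, indexed by `Fin m`, of the orbit of the `n`-th base point. -/
def orbitAlphabet (m : ℕ) (n : ℕ) : Set (Fin m × Ω) := {x | ∃ g, θ g (basePoint Ω n) = x.2}

theorem basePoint_mem_orbitAlphabet (i : Fin m) (n : ℕ) :
    (i, basePoint Ω n) ∈ orbitAlphabet θ m n := ⟨1, by simp⟩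

variable {θ}

theorem apply_mem_orbitAlphabet (hS : Subgroup.closure S = θ.range) (n : ℕ) (d : Perm (Fin m × Ω))
    (hd : d ∈ alternatingTwist (Fin m) S) (x : Fin m × Ω) (hx : x ∈ orbitAlphabet θ m n) :
    d x ∈ orbitAlphabet θ m n := by
  obtain ⟨j, y⟩ := x
  obtain ⟨g, hg⟩ := hx
  obtain ⟨j', h, hh, h1⟩ := Wreath.exists_apply_eq hd j
  rw [hS] at hh
  obtain ⟨g', rfl⟩ := hh
  refine ⟨g' * g, ?_⟩
  rw [h1, map_mul, Perm.mul_apply, hg]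

variable (hm : 5 ≤ m) (hS : Subgroup.closure S = θ.range)

/-- The spinal system over `alternatingTwist (Fin m) S` whose alphabets consist of `m` copies
of the orbits of the action `θ`. -/
noncomputable def ofAction : SpinalSystem (Fin m × Ω) (alternatingTwist (Fin m) S) where
  alphabet := orbitAlphabet θ m
  act n := cutoff _ (orbitAlphabet θ m n) (apply_mem_orbitAlphabet hS n)
  spine n := (⟨0, by omega⟩, basePoint Ω n)
  side n := (⟨1, by omega⟩, basePoint Ω n)
  act_of_notMem n d x hx := cutoff_of_notMem _ d hx
  spine_mem n := basePoint_mem_orbitAlphabet θ _ n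
  side_mem n := basePoint_mem_orbitAlphabet θ _ n
  spine_ne_side n := by simp
  exists_act_eq n := by
    rintro ⟨i, y⟩ ⟨g, hg⟩ ⟨j, z⟩ ⟨h, hh⟩
    simp only at hg hh
    have hmem : θ (h * g⁻¹) ∈ Subgroup.closure S := hS ▸ ⟨_, rfl⟩
    obtain ⟨d, hd, h1⟩ := exists_apply_eq_of_orbit (S := S) (by simpa using hm) i j hmem y
    refine ⟨⟨d, hd⟩, ?_⟩
    rw [cutoff_of_mem (apply_mem_orbitAlphabet hS n) _
      (show (i, y) ∈ orbitAlphabet θ m n from ⟨g, hg⟩),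
      h1, ← hg, ← hh]
    simp
  exists_fix_spine n := by
    obtain ⟨d, hd, h1, c, hc, hc', h2⟩ := exists_fix_move (S := S) (J := Fin m)
      (by simpa using hm) (a := ⟨0, by omega⟩) (b := ⟨1, by omega⟩) (by simp)
    refine ⟨⟨d, hd⟩, ?_⟩
    rw [cutoff_of_mem _ _ (basePoint_mem_orbitAlphabet θ _ n),
      cutoff_of_mem _ _ (basePoint_mem_orbitAlphabet θ _ n), h1, h2]
    exact ⟨rfl, fun h => hc (congrArg Prod.fst h), fun h => hc' (congrArg Prod.fst h)⟩
  exists_fix_side n := by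
    obtain ⟨d, hd, h1, c, hc, hc', h2⟩ := exists_fix_move (S := S) (J := Fin m)
      (by simpa using hm) (a := ⟨1, by omega⟩) (b := ⟨0, by omega⟩) (by simp)
    refine ⟨⟨d, hd⟩, ?_⟩
    rw [cutoff_of_mem _ _ (basePoint_mem_orbitAlphabet θ _ n),
      cutoff_of_mem _ _ (basePoint_mem_orbitAlphabet θ _ n), h1, h2]
    exact ⟨rfl, fun h => hc (congrArg Prod.fst h), fun h => hc' (congrArg Prod.fst h)⟩

theorem ofAction_act_of_mem (n : ℕ) (d : alternatingTwist (Fin m) S) {x : Fin m × Ω}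
    (hx : x ∈ (ofAction hm hS).alphabet n) : (ofAction hm hS).act n d x = d.1 x :=
  cutoff_of_mem (apply_mem_orbitAlphabet hS n) d hx

theorem ofAction_finite_alphabet (hθ : ∀ y, (Set.range fun g => θ g y).Finite) (n : ℕ) :
    ((ofAction hm hS).alphabet n).Finite := by
  refine ((Set.finite_univ (α := Fin m)).prod (hθ (basePoint Ω n))).subset ?_
  rintro x ⟨g, hg⟩
  exact ⟨trivial, g, hg⟩

/-- An element of `alternatingTwist (Fin m) S` that moves a point over `y` is detected by the action
of every index whose base point is `y`. -/
theorem ofAction_act_ne_one {d : alternatingTwist (Fin m) S} {i : Fin m} {y : Ω}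
    (h : d.1 (i, y) ≠ (i, y)) (N : ℕ) :
    (ofAction hm hS).act (Nat.pair (Encodable.encode y) N) d ≠ 1 := by
  intro h1
  apply h
  have hx : ((i, y) : Fin m × Ω) ∈
      (ofAction hm hS).alphabet (Nat.pair (Encodable.encode y) N) :=
    ⟨1, by simp [basePoint_pair]⟩
  rw [← ofAction_act_of_mem hm hS _ d hx, h1]
  rfl

theorem ofAction_exists_act_ne_one {d : alternatingTwist (Fin m) S} (hd : d ≠ 1) (N : ℕ) :
    ∃ j, N ≤ j ∧ (ofAction hm hS).act j d ≠ 1 := by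
  obtain ⟨⟨i, y⟩, hx⟩ : ∃ x, d.1 x ≠ x := by
    by_contra! h
    exact hd (Subtype.ext (Equiv.ext h))
  exact ⟨_, Nat.right_le_pair _ _, ofAction_act_ne_one hm hS hx N⟩

/-! ### Computability of the spinal group -/

/-- One step of the transducer for the action of rooted and directed elements. The state `(n, c)`
consists of the level `n` and a control value `c`, which is `0` on the spine, `1` if the next letter
is to be changed, and `2` if all further letters are to be copied. -/
def transducerStep {L : Type} [DecidableEq L] (o p : ℕ → L) (d : L → L)
    (st : (ℕ × Fin 3) × List L) (x : L) : (ℕ × Fin 3) × List L :=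
  ((st.1.1 + 1, if st.1.2 = 0 then (if x = o st.1.1 then 0 else if x = p st.1.1 then 1 else 2)
    else 2), st.2 ++ [if st.1.2 = 1 then d x else x])

/-- The action of a rooted (`b = false`) or directed (`b = true`) element on words. -/
def transducer {L : Type} [DecidableEq L] (o p : ℕ → L) (d : L → L) (b : Bool) (v : List L) :
    List L := (v.foldl (transducerStep o p d) ((0, if b then 0 else 1), [])).2

theorem computable_transducer {L : Type} [DecidableEq L] [Primcodable L] {o p : ℕ → L} {d : L → L}
    (ho : Computable o) (hp : Computable p) (hd : Computable d) (b : Bool) :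
    Computable (transducer o p d b) := by
  refine Computable.snd.comp (Computable.list_foldl
    (h := fun _ x => transducerStep o p d x.1 x.2) Computable.id (Computable.const _) ?_)
  have hst : Computable fun x : List L × (((ℕ × Fin 3) × List L) × L) => x.2.1 :=
    Computable.fst.comp Computable.snd
  have hx : Computable fun x : List L × (((ℕ × Fin 3) × List L) × L) => x.2.2 :=
    Computable.snd.comp Computable.snd
  have hn := Computable.fst.comp (Computable.fst.comp hst)
  have hc := Computable.snd.comp (Computable.fst.comp hst)
  refine Computable.pair (Computable.pair (Computable.succ.comp hn) ?_) ?_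
  · exact .ite_computablePred (.eq hc (.const 0))
      (.ite_computablePred (.eq hx (ho.comp hn)) (.const 0)
        (.ite_computablePred (.eq hx (hp.comp hn)) (.const 1) (.const 2))) (.const 2)
  · exact Computable.list_concat.comp (Computable.snd.comp hst)
      (.ite_computablePred (.eq hc (.const 1)) (hd.comp hx) hx)

section Transducer

variable [DecidableEq Ω] (d : alternatingTwist (Fin m) S)

theorem foldl_transducerStep_two (n : ℕ) (out v : List (Fin m × Ω)) :
    (v.foldl (transducerStep (ofAction hm hS).spine (ofAction hm hS).side d.1)
      ((n, 2), out)).2 = out ++ v := by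
  induction v generalizing n out with
  | nil => simp
  | cons x v ih =>
    rw [List.foldl_cons]
    simp [transducerStep, ih]

theorem foldl_transducerStep_one (n : ℕ) (out : List (Fin m × Ω)) {v : List (Fin m × Ω)}
    (hv : (ofAction hm hS).Valid n v) :
    (v.foldl (transducerStep (ofAction hm hS).spine (ofAction hm hS).side d.1) ((n, 1), out)).2 =
      out ++ (ofAction hm hS).rooted n d v := by
  cases v with
  | nil => simp [rooted, headPerm_nil]
  | cons x v =>
    rw [List.foldl_cons, rooted_cons, ofAction_act_of_mem hm hS n d hv.1]
    have h1 := foldl_transducerStep_two hm hS d (n + 1) (out ++ [d.1 x]) v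
    simpa [transducerStep] using h1

theorem foldl_transducerStep_zero (n : ℕ) (out : List (Fin m × Ω)) {v : List (Fin m × Ω)}
    (hv : (ofAction hm hS).Valid n v) :
    (v.foldl (transducerStep (ofAction hm hS).spine (ofAction hm hS).side d.1) ((n, 0), out)).2 =
      out ++ (ofAction hm hS).directed n d v := by
  induction v generalizing n out with
  | nil =>
    rw [(ofAction hm hS).apply_nil ((ofAction hm hS).directed_mem n d)]
    simp
  | cons x v ih =>
    rw [List.foldl_cons, directed_cons]
    have h2 := foldl_transducerStep_two hm hS d (n + 1) (out ++ [x]) v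
    have h1 := foldl_transducerStep_one hm hS d (n + 1) (out ++ [x]) hv.2
    have h0 := ih (n + 1) (out ++ [x]) hv.2
    by_cases hs : x = (ofAction hm hS).spine n
    · rw [if_pos hs]
      simpa [transducerStep, if_pos hs] using h0
    · by_cases hs' : x = (ofAction hm hS).side n
      · rw [if_neg hs, if_pos hs']
        simpa [transducerStep, if_neg hs, if_pos hs'] using h1
      · rw [if_neg hs, if_neg hs']
        simpa [transducerStep, if_neg hs, if_neg hs'] using h2

theorem transducer_eq (b : Bool) {v : List (Fin m × Ω)} (hv : (ofAction hm hS).Valid 0 v) :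
    transducer (ofAction hm hS).spine (ofAction hm hS).side d.1 b v =
      (ofAction hm hS).letter 0 (b, d) v := by
  cases b
  · exact (foldl_transducerStep_one hm hS d 0 [] hv).trans (List.nil_append _)
  · exact (foldl_transducerStep_zero hm hS d 0 [] hv).trans (List.nil_append _)

end Transducer

end SpinalSystem

theorem Computable.list_sublists' {α : Type*} [Primcodable α] :
    Computable (List.sublists' : List α → List (List α)) := by
  refine (Computable.list_foldr (h := fun _ (p : α × List (List α)) => p.2 ++ p.2.map (p.1 :: ·))
    Computable.id (Computable.const [[]]) ?_).of_eq fun l => ?_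
  · exact Computable.list_append.comp (Computable.snd.comp Computable.snd)
      (Computable.list_map (Computable.snd.comp Computable.snd)
        (Computable.list_cons.comp
          (Computable.fst.comp (Computable.snd.comp Computable.fst)) Computable.snd))
  · induction l with
    | nil => simp
    | cons a l ih =>
      rw [List.sublists'_cons, ← ih]
      rfl

namespace SpinalSystem

open Equiv (Perm)
open Wreath

section Generators

variable {L : Type*} {D : Type*} [Group D] (P : SpinalSystem L D) [DecidableEq L] {k r : ℕ}
  (t : Fin r → D) (e : Fin k ≃ Bool × Fin r)

theorem letter_mem (n : ℕ) (c : Bool × D) : P.letter n c ∈ P.group n := by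
  obtain ⟨b, d⟩ := c
  cases b
  · exact P.rooted_mem n d
  · exact P.directed_mem n d

/-- An enumeration of the rooted and directed generators. -/
def generatorEquiv (r : ℕ) : Fin (2 * r) ≃ Bool × Fin r :=
  finProdFinEquiv.symm.trans (finTwoEquiv.prodCongr (Equiv.refl (Fin r)))

/-- The rooted and directed elements of generators of `D` as generators of the spinal group. -/
def generator (i : Fin k) : P.group 0 :=
  ⟨P.letter 0 ((e i).1, t (e i).2), P.letter_mem 0 _⟩

theorem isSymmetricGenerating_generator (ht : IsSymmetricGenerating t) :
    IsSymmetricGenerating (P.generator t e) := by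
  constructor
  · have hle : P.group 0 ≤
        (Subgroup.closure (Set.range (P.generator t e))).map (P.group 0).subtype := by
      have key : ∀ (b : Bool) (f : D →* Perm (List L)), (∀ d, f d = P.letter 0 (b, d)) → ∀ d,
          f d ∈ (Subgroup.closure (Set.range (P.generator t e))).map (P.group 0).subtype := by
        intro b f hf d
        suffices H : Subgroup.closure (Set.range t) ≤
            ((Subgroup.closure (Set.range (P.generator t e))).map (P.group 0).subtype).comap f by
          rw [ht.closure_eq_top] at H
          exact H (Subgroup.mem_top d)
        rw [Subgroup.closure_le]
        rintro _ ⟨c, rfl⟩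
        refine ⟨P.generator t e (e.symm (b, c)), Subgroup.subset_closure ⟨_, rfl⟩, ?_⟩
        simp [generator, hf]
      refine (Subgroup.closure_le _).2 ?_
      rintro _ (⟨d, rfl⟩ | ⟨d, rfl⟩)
      · exact key false (P.rooted 0) (fun _ => rfl) d
      · exact key true (P.directed 0) (fun _ => rfl) d
    rw [eq_top_iff]
    rintro γ -
    obtain ⟨γ', hγ', h⟩ := hle γ.2
    rwa [← Subtype.ext h]
  · intro i
    obtain ⟨c, hc⟩ := ht.inv_mem (e i).2
    refine ⟨e.symm ((e i).1, c), Subtype.ext ?_⟩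
    simp only [InvMemClass.coe_inv, generator, Equiv.apply_symm_apply, hc]
    cases (e i).1
    · exact map_inv (P.rooted 0) _
    · exact map_inv (P.directed 0) _

theorem coe_wordEval_generator (w : List (Fin k)) :
    ((wordEval (P.generator t e) w : P.group 0) : Perm (List L)) =
    P.eval 0 (w.map fun i => ((e i).1, t (e i).2)) := by
  induction w with
  | nil => rfl
  | cons i w ih =>
    rw [wordEval_cons, Subgroup.coe_mul, ih, List.map_cons, eval_cons]
    rfl

end Generators

section Computability

variable {Ω : Type} [Denumerable Ω] {G : Type u} [Group G] {m : ℕ} {S : Set (Perm Ω)}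
  {θ : G →* Perm Ω} (hm : 5 ≤ m) (hS : Subgroup.closure S = θ.range)

theorem computable_of_mem_alternatingTwist (hS : Subgroup.closure S = θ.range)
    (hθ : ∀ g, Computable (θ g)) {d : Perm (Fin m × Ω)}
    (hd : d ∈ alternatingTwist (Fin m) S) : Computable d := by
  choose j' h hh h1 using Wreath.exists_apply_eq hd
  refine ((Computable.of_forall_fin (f := fun j y => (j' j, h j y)) fun j => ?_).comp Computable.fst
    Computable.snd).of_eq fun x => (h1 x.1 x.2).symm
  obtain ⟨g, hg⟩ : h j ∈ θ.range := hS ▸ hh j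
  refine Computable.pair (Computable.const _) ?_
  rw [← hg]
  exact hθ g

/-- The alternating twist inherits the solvable word problem: a word acts on the copies of the set
by elements of the group that can be written as words. -/
theorem computablePred_wordEval_alternatingTwist (hS : Subgroup.closure S = θ.range)
    (hinj : Function.Injective θ) (hwp : HasSolvableWordProblem G) {r : ℕ}
    (t : Fin r → alternatingTwist (Fin m) S) :
    ComputablePred fun u : List (Fin r) => wordEval t u = 1 := by
  obtain ⟨l, s, hs, hp⟩ := hwp
  have key : ∀ (c : Fin r) (j : Fin m), ∃ (j' : Fin m) (v : List (Fin l)),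
      ∀ y, (t c).1 (j, y) = (j', θ (wordEval s v) y) := fun c j => by
    obtain ⟨j', h, hh, h1⟩ := Wreath.exists_apply_eq (t c).2 j
    obtain ⟨g, hg⟩ : h ∈ θ.range := hS ▸ hh
    obtain ⟨v, rfl⟩ := hs.exists_wordEval g
    exact ⟨j', v, fun y => by rw [h1, ← hg]⟩
  choose next out hkey using key
  let run : Fin m → List (Fin r) → Fin m × List (Fin l) := fun j u =>
    u.foldr (fun c st => (next c st.1, out c st.1 ++ st.2)) (j, [])
  have hrun : ∀ j u y, (wordEval t u).1 (j, y) = ((run j u).1, θ (wordEval s (run j u).2) y) := by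
    intro j u y
    induction u with
    | nil => simp [run, wordEval_nil]
    | cons c u ih =>
      rw [wordEval_cons, Subgroup.coe_mul, Perm.mul_apply, ih, hkey]
      simp [run, wordEval_append]
  have hcomp : ∀ j, Computable (run j) := fun j => by
    refine Computable.list_foldr (h := fun _ (p : Fin r × (Fin m × List (Fin l))) =>
      (next p.1 p.2.1, out p.1 p.2.1 ++ p.2.2)) Computable.id (Computable.const _) ?_
    have hc : Computable fun p : List (Fin r) × (Fin r × (Fin m × List (Fin l))) =>
        (p.2.1, p.2.2.1) := Computable.pair (Computable.fst.comp Computable.snd)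
          (Computable.fst.comp (Computable.snd.comp Computable.snd))
    refine Computable.pair
      ((Primrec.dom_finite fun x : Fin r × Fin m => next x.1 x.2).to_comp.comp hc) ?_
    exact Computable.list_append.comp
      ((Primrec.dom_finite fun x : Fin r × Fin m => out x.1 x.2).to_comp.comp hc)
      (Computable.snd.comp (Computable.snd.comp Computable.snd))
  refine (ComputablePred.forall_fin (p := fun j u =>
    (run j u).1 = j ∧ wordEval s (run j u).2 = 1) fun j => ?_).of_eq
      fun u => ⟨fun H => ?_, fun H j => ?_⟩
  · exact (ComputablePred.eq (Computable.fst.comp (hcomp j)) (.const j)).and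
      (hp.comp (Computable.snd.comp (hcomp j)))
  · refine Subtype.ext (Equiv.ext fun x => ?_)
    rw [← Prod.mk.eta (p := x), hrun, (H x.1).1, (H x.1).2, map_one]
    rfl
  · have h1 : ∀ y, ((run j u).1, θ (wordEval s (run j u).2) y) = (j, y) := fun y => by
      rw [← hrun, H]; rfl
    refine ⟨congrArg Prod.fst (h1 (basePoint Ω 0)), hinj ?_⟩
    rw [map_one]
    exact Equiv.ext fun y => congrArg Prod.snd (h1 y)

variable [DecidableEq Ω] {k r : ℕ} {t : Fin r → alternatingTwist (Fin m) S}
  (e : Fin k ≃ Bool × Fin r)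

theorem computableOrbits (hθ : ∀ g, Computable (θ g))
    (hfin : ∀ y, (Set.range fun g => θ g y).Finite)
    (ht : IsSymmetricGenerating t) :
    ComputableOrbits ((ofAction hm hS).generator t e) ((ofAction hm hS).group 0).subtype
      ((ofAction hm hS).spineWord 0)
      (fun i => transducer (ofAction hm hS).spine (ofAction hm hS).side (t (e i).2).1 (e i).1) where
  isSymmetricGenerating := isSymmetricGenerating_generator _ t e ht
  computable_base := by
    have hr : Computable fun n : ℕ => List.range' 0 n :=
      Primrec.list_range.to_comp.of_eq fun n => List.range_eq_range'
    exact Computable.list_map hr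
      (Computable.pair (Computable.const _) (computable_basePoint.comp Computable.snd))
  computable_raw i := computable_transducer
    (Computable.pair (Computable.const _) computable_basePoint)
    (Computable.pair (Computable.const _) computable_basePoint)
    (computable_of_mem_alternatingTwist hS hθ (t (e i).2).2) _
  raw_eq n i g := transducer_eq hm hS _ _
    ((ofAction hm hS).valid_apply g.2 ((ofAction hm hS).valid_spineWord 0 n))
  finite_orbit n := by
    refine ((ofAction hm hS).finite_valid (ofAction_finite_alphabet hm hS hfin) 0 n).subset ?_
    rintro _ ⟨g, rfl⟩
    exact ⟨(ofAction hm hS).valid_apply g.2 ((ofAction hm hS).valid_spineWord 0 n),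
      ((ofAction hm hS).length_apply g.2 _).trans ((ofAction hm hS).length_spineWord 0 n)⟩

/-- The words of length `n` are the orbit of the word along the spine. -/
theorem forall_orbit_spineWord_iff (γ : (ofAction hm hS).group 0) (n : ℕ) :
    (∀ g : (ofAction hm hS).group 0, γ.1 (g.1 ((ofAction hm hS).spineWord 0 n)) =
      g.1 ((ofAction hm hS).spineWord 0 n)) ↔
    ∀ v, (ofAction hm hS).Valid 0 v → v.length = n → γ.1 v = v := by
  refine ⟨fun H v hv hn => ?_, fun H g => H _
    ((ofAction hm hS).valid_apply g.2 ((ofAction hm hS).valid_spineWord 0 n))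
      (((ofAction hm hS).length_apply g.2 _).trans ((ofAction hm hS).length_spineWord 0 n))⟩
  obtain ⟨g, hg, h1⟩ := (ofAction hm hS).exists_apply_eq
    (commutator_alternatingTwist_eq_top (by simpa using hm)) ((ofAction hm hS).valid_spineWord 0 n)
    hv (((ofAction hm hS).length_spineWord 0 n).trans hn.symm)
  rw [← h1]
  exact H ⟨g, hg⟩

theorem isEFRFPlus_group (hθ : ∀ g, Computable (θ g))
    (hfin : ∀ y, (Set.range fun g => θ g y).Finite) (ht : IsSymmetricGenerating t) :
    IsEFRFPlus ((ofAction hm hS).group 0) := by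
  refine (computableOrbits hm hS (generatorEquiv r) hθ hfin ht).isEFRFPlus fun γ hγ => ?_
  exact Subtype.ext ((ofAction hm hS).eq_one_of_forall_valid γ.2 0 fun v hv _ =>
    (forall_orbit_spineWord_iff hm hS γ v.length).1 (hγ _) v hv rfl)

/-- A nontrivial word in generators of the alternating twist moves a point that can be computed
from the word. -/
theorem exists_computable_moved (hS : Subgroup.closure S = θ.range) (hθ : ∀ g, Computable (θ g))
    (hinj : Function.Injective θ) (hwp : HasSolvableWordProblem G) :
    ∃ f : List (Fin r) → Ω, Computable f ∧ ∀ u, wordEval t u ≠ 1 →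
      ∃ i, (wordEval t u).1 (i, f u) ≠ (i, f u) := by
  have hfold : ∀ u x, (wordEval t u).1 x = u.foldr (fun c x => (t c).1 x) x := fun u x => by
    induction u with
    | nil => rfl
    | cons c u ih => rw [wordEval_cons, Subgroup.coe_mul, Perm.mul_apply, ih, List.foldr_cons]
  have hp : ComputablePred fun x : List (Fin r) × Ω =>
      wordEval t x.1 = 1 ∨ ∃ i, (wordEval t x.1).1 (i, x.2) ≠ (i, x.2) := by
    refine ((computablePred_wordEval_alternatingTwist hS hinj hwp t).comp Computable.fst).or
      (ComputablePred.exists_fin fun i => ?_)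
    have hi : Computable fun x : List (Fin r) × Ω => (i, x.2) :=
      Computable.pair (Computable.const i) Computable.snd
    refine (ComputablePred.eq ((Computable.list_foldr
      (h := fun _ (p : Fin r × (Fin m × Ω)) => (t p.1).1 p.2) Computable.fst hi ?_).of_eq
        fun x => (hfold _ _).symm) hi).not
    exact (Computable.of_forall_fin fun c =>
      computable_of_mem_alternatingTwist hS hθ (t c).2).comp
        (Computable.fst.comp Computable.snd) (Computable.snd.comp Computable.snd)
  obtain ⟨f, hf, h⟩ := Computable.exists_choice (p := fun (u : List (Fin r)) (y : Ω) =>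
    wordEval t u = 1 ∨ ∃ i, (wordEval t u).1 (i, y) ≠ (i, y)) hp fun u => by
      by_cases hu : wordEval t u = 1
      · exact ⟨basePoint Ω 0, Or.inl hu⟩
      · by_contra! H
        exact hu (Subtype.ext (Equiv.ext fun x => (H x.2).2 x.1))
  exact ⟨f, hf, fun u hu => (h u).resolve_left hu⟩

/-- The word problem of the spinal group is solved by testing the action on a level that can be
computed from the word. -/
theorem hasSolvableWordProblem_group (hθ : ∀ g, Computable (θ g))
    (hfin : ∀ y, (Set.range fun g => θ g y).Finite) (hinj : Function.Injective θ)
    (hwp : HasSolvableWordProblem G) (ht : IsSymmetricGenerating t) :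
    HasSolvableWordProblem ((ofAction hm hS).group 0) := by
  let e := generatorEquiv r
  obtain ⟨f, hf, hmoved⟩ := exists_computable_moved (t := t) hS hθ hinj hwp
  have horb := computableOrbits hm hS e hθ hfin ht
  let subwords : List (Fin (2 * r)) → List (List (Fin r)) := fun w =>
    (w.map fun i => (e i).2).sublists'
  -- an index of the orbit of the point moved by `u`, larger than the number of letters of `w`
  let index : List (Fin (2 * r)) → List (Fin r) → ℕ := fun w u =>
    Nat.pair (Encodable.encode (f u)) (w.length + 1)
  let level : List (Fin (2 * r)) → ℕ := fun w =>
    (subwords w).foldr (fun u M => max (index w u) M) w.length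
  have hindex : ∀ w, ∀ u ∈ subwords w, index w u ≤ level w := fun w u => by
    simp only [level]
    induction subwords w with
    | nil => simp
    | cons a l ih =>
      intro hu
      rcases List.mem_cons.1 hu with rfl | hu
      · exact le_max_left _ _
      · exact (ih hu).trans (le_max_right _ _)
  have hlength : ∀ w, w.length ≤ level w := fun w => by
    simp only [level]
    induction subwords w with
    | nil => exact le_rfl
    | cons a l ih => exact ih.trans (le_max_right _ _)
  have hlevel : Computable level := by
    refine Computable.list_foldr (h := fun w (p : List (Fin r) × ℕ) => max (index w p.1) p.2)
      (Computable.list_sublists'.comp (Computable.list_map Computable.id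
        ((Primrec.dom_finite fun i => (e i).2).to_comp.comp Computable.snd)))
      Computable.list_length ?_
    refine Primrec.nat_max.to_comp.comp ?_ (Computable.snd.comp Computable.snd)
    exact Primrec₂.natPair.to_comp.comp
      (Computable.encode.comp (hf.comp (Computable.fst.comp Computable.snd)))
      (Computable.succ.comp (Computable.list_length.comp Computable.fst))
  refine ⟨_, _, horb.isSymmetricGenerating, (horb.computablePred_forall_orbit.comp
    (Computable.pair Computable.id (Computable.succ.comp hlevel))).of_eq fun w => ?_⟩
  refine (forall_orbit_spineWord_iff hm hS _ _).trans ⟨fun H => ?_, fun H v _ _ =>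
    congrArg (fun γ : (ofAction hm hS).group 0 => γ.1 v) H⟩
  have hmem := (wordEval ((ofAction hm hS).generator t e) w).2
  refine Subtype.ext ?_
  have H' : ∀ v, (ofAction hm hS).Valid 0 v → v.length ≤ level w + 1 - 0 →
      (wordEval ((ofAction hm hS).generator t e) w).1 v = v :=
    fun v hv hl => (ofAction hm hS).apply_eq_of_length_le hmem H hv hl
  rw [coe_wordEval_generator] at H' ⊢
  have hmap : (w.map fun i => ((e i).1, t (e i).2)).map Prod.snd =
      (w.map fun i => (e i).2).map t := by simp
  refine (ofAction hm hS).eval_eq_one_of_level (k := w.length) ?_ (by simpa using hlength w) ?_ H'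
  · exact (directedPart_sublist _).length_le.trans (by simp)
  · intro u hu hne
    obtain ⟨u', hu', rfl⟩ := List.sublist_map_iff.1 (hmap ▸ hu.trans (directedPart_sublist _))
    obtain ⟨i, hi⟩ := hmoved u' hne
    refine ⟨index w u', ?_, hindex w u' (List.mem_sublists'.2 hu'), ofAction_act_ne_one hm hS hi _⟩
    simpa using Nat.right_le_pair (Encodable.encode (f u')) (w.length + 1)

end Computability

end SpinalSystem

/-! ### Embedding into a branch group -/

theorem IsSymmetricGenerating.map_mulEquiv {G : Type*} {H : Type u} [Group G] [Group H] {k : ℕ}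
    {s : Fin k → G} (hs : IsSymmetricGenerating s) (e : G ≃* H) :
    IsSymmetricGenerating (e ∘ s) := by
  refine ⟨?_, fun i => (hs.inv_mem i).imp fun j hj => by simp [hj]⟩
  have h1 := MonoidHom.map_closure (e : G →* H) (Set.range s)
  rw [hs.closure_eq_top, ← MonoidHom.range_eq_map, MonoidHom.range_eq_top.2 e.surjective] at h1
  rw [Set.range_comp]
  exact h1.symm

theorem wordEval_comp {G : Type*} {H : Type u} [Group G] [Group H] {k : ℕ} (s : Fin k → G)
    (f : G →* H) (w : List (Fin k)) : wordEval (f ∘ s) w = f (wordEval s w) := by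
  simp [wordEval, map_list_prod]

theorem HasSolvableWordProblem.of_mulEquiv {G : Type*} {H : Type u} [Group G] [Group H]
    (h : HasSolvableWordProblem G) (e : G ≃* H) : HasSolvableWordProblem H := by
  obtain ⟨k, s, hs, hp⟩ := h
  refine ⟨k, e ∘ s, hs.map_mulEquiv e, hp.of_eq fun w => ?_⟩
  rw [show wordEval (e ∘ s) w = e (wordEval s w) from wordEval_comp s (e : G →* H) w]
  simp

theorem HasSolvableWordProblem.fg {G : Type u} [Group G] (h : HasSolvableWordProblem G) :
    Group.FG G :=
  h.choose_spec.choose_spec.1.fg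

theorem IsEFRFPlus.of_mulEquiv {G : Type*} {H : Type u} [Group G] [Group H]
    (h : IsEFRFPlus G) (e : G ≃* H) : IsEFRFPlus H := by
  obtain ⟨k, s, hs, M, hM, hMw⟩ := h
  have he : ∀ w, wordEval (e ∘ s) w = e (wordEval s w) := wordEval_comp s (e : G →* H)
  refine ⟨k, e ∘ s, hs.map_mulEquiv e, M, hM, fun w => ⟨?_, fun out hout => ?_⟩⟩
  · rw [(hMw w).1, he]
    simp
  · obtain ⟨φ, hφ, hne⟩ := (hMw w).2 out hout
    refine ⟨φ.comp (e.symm : H →* G), fun i => ?_, by simpa [he] using hne⟩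
    simpa using hφ i

theorem exists_generators_alternatingTwist {J Ω : Type*} [DecidableEq J] [Fintype J]
    {S : Set (Equiv.Perm Ω)} (hS : S.Finite) :
    ∃ (r : ℕ) (t : Fin r → Wreath.alternatingTwist J S), IsSymmetricGenerating t :=
  exists_isSymmetricGenerating (T := Subtype.val ⁻¹' Wreath.generators J S)
    ((Wreath.finite_generators hS).preimage Subtype.val_injective.injOn)
    (Subgroup.closure_closure_coe_preimage (k := Wreath.generators J S))

/-- A finitely generated permutation group embeds diagonally, twisted by endomorphisms with product
in the commutator subgroup, into a finitely generated perfect group of permutations of finitely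
many copies of the set on which it acts. -/
theorem exists_injective_alternatingTwist {G : Type u} [Group G] [Group.FG G] {Ω : Type*}
    {θ : G →* Equiv.Perm Ω} (hθ : Function.Injective θ) {S : Set (Equiv.Perm Ω)}
    (hS : Subgroup.closure S = θ.range) : ∃ m, 5 ≤ m ∧
      ∃ ι : G →* Wreath.alternatingTwist (Fin m) S, Function.Injective ι := by
  obtain ⟨m, γ, hm, ⟨j, hj⟩, hγ⟩ := exists_endomorphisms_prod_mem_commutator G
  have hmem : ∀ g, Wreath.diag (fun i => θ (γ i g)) ∈ Wreath.alternatingTwist (Fin m) S := by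
    refine fun g => Wreath.diag_mem (by simpa using hm) (fun i => hS ▸ ⟨_, rfl⟩)
      (List.nodup_finRange m) List.mem_finRange ?_
    have h1 := Subgroup.mem_map_of_mem θ (hγ g)
    rw [commutator_def, Subgroup.map_commutator, ← MonoidHom.range_eq_map, ← hS, map_list_prod,
      List.ofFn_eq_map, List.map_map] at h1
    exact h1
  refine ⟨m, hm,
    { toFun := fun g => ⟨_, hmem g⟩
      map_one' := Subtype.ext (Equiv.ext fun x => by simp [Wreath.diag_apply])
      map_mul' := fun g h => Subtype.ext (Equiv.ext fun x => by simp [Wreath.diag_apply]) },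
    fun g h hgh => hθ (Equiv.ext fun y => ?_)⟩
  have h1 := congrArg (fun d : Wreath.alternatingTwist (Fin m) S => (d.1 (j, y)).2) hgh
  have h2 : θ (γ j g) y = θ (γ j h) y := h1
  rwa [hj] at h2

/-- An `EFRF⁺` group with solvable word problem embeds into a branch group with the same
properties, the spinal group of its action. -/
theorem IsEFRFPlus.exists_branchGroup {G : Type u} [Group G] (hG : IsEFRFPlus G)
    (hwp : HasSolvableWordProblem G) : ∃ (Γ : Type) (_ : Group Γ), IsBranchGroup (ULift.{u} Γ) ∧
      IsEFRFPlus Γ ∧ HasSolvableWordProblem Γ ∧ ∃ f : G →* Γ, Function.Injective f := by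
  obtain ⟨θ, hinj, hfin, hcomp⟩ := hG.exists_action
  have : Group.FG G := hwp.fg
  obtain ⟨k, s, hs, -⟩ := id hwp
  have hS : Subgroup.closure (θ '' Set.range s) = θ.range := by
    rw [← MonoidHom.map_closure, hs.closure_eq_top, MonoidHom.range_eq_map]
  have hSfin : (θ '' Set.range s).Finite := (Set.finite_range s).image _
  generalize θ '' Set.range s = S at hS hSfin
  obtain ⟨m, hm, ι, hι⟩ := exists_injective_alternatingTwist hinj hS
  obtain ⟨r, t, ht⟩ := exists_generators_alternatingTwist (J := Fin m) hSfin
  have hdir := (SpinalSystem.ofAction hm hS).directed_injective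
    (fun d hd N => SpinalSystem.ofAction_exists_act_ne_one hm hS hd N) 0
  refine ⟨(SpinalSystem.ofAction hm hS).group 0, inferInstance,
    SpinalSystem.isBranchGroup_of_mulEquiv _
      (Wreath.commutator_alternatingTwist_eq_top (by simpa using hm))
      (SpinalSystem.ofAction_finite_alphabet hm hS hfin) MulEquiv.ulift,
    SpinalSystem.isEFRFPlus_group hm hS hcomp hfin ht,
    SpinalSystem.hasSolvableWordProblem_group hm hS hcomp hfin hinj hwp ht,
    (((SpinalSystem.ofAction hm hS).directed 0).codRestrict _
      ((SpinalSystem.ofAction hm hS).directed_mem 0)).comp ι,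
    fun g g' h => hι (hdir (congrArg Subtype.val h))⟩

/-- For an `EFRF⁺` subgroup of a finitely presented group, both the trivial and the nontrivial
words are recursively enumerable. -/
theorem IsEFRFPlus.hasSolvableWordProblem {G : Type u} {H : Type*} [Group G] [Group H]
    (hG : IsEFRFPlus G) (hH : Group.IsFinitelyPresented H) {f : G →* H}
    (hf : Function.Injective f) : HasSolvableWordProblem G := by
  obtain ⟨k, s, hs, M, hM, hMw⟩ := hG
  exact ⟨k, s, hs, ComputablePred.computable_iff_re_compl_re'.2
    ⟨rePred_wordEval_eq_one hH hf s, hM.dom_re.of_eq fun w => (hMw w).1⟩⟩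

theorem mainTheorem6
    (h : BooneHigmanFor.{u} fun G _ => IsBranchGroup G ∧ IsEFRFPlus G) :
    BooneHigmanFor.{u} fun G _ => IsEFRFPlus G := by
  intro G _ hG _
  constructor
  · intro hwp
    obtain ⟨Γ, _, hbranch, hΓ, hwpΓ, f, hf⟩ := hG.exists_branchGroup hwp
    let e : Γ ≃* ULift.{u} Γ := MulEquiv.ulift.symm
    have hwpΓ' := hwpΓ.of_mulEquiv e
    obtain ⟨H, _, hfp, hsimple, f', hf'⟩ :=
      (h (ULift.{u} Γ) ⟨hbranch, hΓ.of_mulEquiv e⟩ hwpΓ'.fg).1 hwpΓ'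
    exact ⟨H, _, hfp, hsimple, (f'.comp (e : Γ →* ULift.{u} Γ)).comp f,
      (hf'.comp e.injective).comp hf⟩
  · rintro ⟨H, _, hfp, -, f, hf⟩
    exact hG.hasSolvableWordProblem hfp hf
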